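/- Let $N\ge 0$ and $r\ge 0$ be integers. Consider the $2(2N+1)$-dimensional real vector space of maps $S^1=\mathbb R/2\pi\mathbb Z\to\mathbb R^2$, $\varphi\mapsto(x(\varphi),y(\varphi))$, where $$x(\varphi)=a_0+\sum_{j=1}^N(a_j\cos j\varphi+b_j\sin j\varphi),\qquad y(\varphi)=\tilde a_0+\sum_{j=1}^N(\tilde a_j\cos j\varphi+\tilde b_j\sin j\varphi)$$ with real coefficients, equipped with the $W_2^r$ dot product $$\langle (x_1,y_1),(x_2,y_2)\rangle=\frac1\pi\int_0^{2\pi}\sum_{q=0}^r\left(x_1^{(q)}(\varphi)x_2^{(q)}(\varphi)+y_1^{(q)}(\varphi)y_2^{(q)}(\varphi)\right)d\varphi .$$ Let $B$ be the unit ball of this Euclidean space. For almost all pairs $(f,g)\in B\times B$, with respect to the Euclidean volume, the set of pairs $(\varphi,\psi)\in S^1\times S^1$ with $f(\varphi)=g(\psi)$ is finite and has as many elements as the set $f(S^1)\cap g(S^1)$ of intersection points of the two curves. For $i\ge 0$, the set of pairs $(f,g)\in B\times B$ such that $f(S^1)\cap g(S^1)$ has exactly $i$ elements is measurable (with respect to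 the completed volume); let $A_i$ be its volume divided by the volume of $B\times B$. Then the average number of intersection points is $$\sum_{i=0}^\infty i\,A_i=\frac{2^{8N+3}\,\lambda_r(N)^2\,((2N)!)^4\,(2N+1)}{\mu(N)\,((4N+1)!)^2},$$ where $\tau_j=1+j^2+\dots+j^{2r}$, $\mu(N)=1+2\sum_{j=1}^N\frac1{\tau_j}$ and $\lambda_r(N)=\left(\sum_{j=1}^N\frac{j^2}{\tau_j}\right)^{1/2}$. -/

import Mathlib

open MeasureTheory Set

noncomputable section

/-- The coefficients `(a₀, …, a_N)` and `(b₁, …, b_N)` of a real Fourier polynomial of degree `≤ N`;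
the coefficient `b_{j+1}` is stored at the index `j : Fin N`. -/
abbrev FourierPoly (N : ℕ) : Type := (Fin (N + 1) → ℝ) × (Fin N → ℝ)

/-- The function
`φ ↦ a₀ + a₁ cos φ + ⋯ + a_N cos N φ + b₁ sin φ + ⋯ + b_N sin N φ`. -/
def FourierPoly.eval {N : ℕ} (p : FourierPoly N) (φ : ℝ) : ℝ :=
  ∑ j : Fin (N + 1), p.1 j * Real.cos ((j : ℕ) * φ) +
    ∑ j : Fin N, p.2 j * Real.sin (((j : ℕ) + 1 : ℝ) * φ)

/-- The vector space (of dimension `2 (2 N + 1)`) of trigonometric plane curves of degree `≤ N`: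
pairs of Fourier polynomials, the coordinates `x` and `y` of the curve. -/
abbrev TrigCurve (N : ℕ) : Type := FourierPoly N × FourierPoly N

/-- The parametrized plane curve, as a `2π`-periodic map of the real line to the plane. -/
def TrigCurve.eval {N : ℕ} (f : TrigCurve N) (φ : ℝ) : ℝ × ℝ :=
  (FourierPoly.eval f.1 φ, FourierPoly.eval f.2 φ)

/-- The `W₂ʳ` dot product of two curves `(x₁, y₁)` and `(x₂, y₂)`:
`(1/π) ∫₀^{2π} ∑_{q=0}^r (x₁^{(q)} x₂^{(q)} + y₁^{(q)} y₂^{(q)}) dφ`. -/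
def sobolevDot (r : ℕ) {N : ℕ} (f g : TrigCurve N) : ℝ :=
  (1 / Real.pi) * ∫ φ in (0 : ℝ)..(2 * Real.pi), ∑ q ∈ Finset.range (r + 1),
    (iteratedDeriv q (FourierPoly.eval f.1) φ * iteratedDeriv q (FourierPoly.eval g.1) φ +
      iteratedDeriv q (FourierPoly.eval f.2) φ * iteratedDeriv q (FourierPoly.eval g.2) φ)

/-- The `W₂ʳ` norm of a curve. -/
def sobolevNorm (r : ℕ) {N : ℕ} (f : TrigCurve N) : ℝ := Real.sqrt (sobolevDot r f f)

/-- The unit ball of the `W₂ʳ` metric in the space of curves of degree `≤ N`. -/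
def sobolevBall (r N : ℕ) : Set (TrigCurve N) := {f | sobolevNorm r f ≤ 1}

/-- The space of pairs of curves from the unit ball. -/
def sobolevBallSq (r N : ℕ) : Set (TrigCurve N × TrigCurve N) :=
  sobolevBall r N ×ˢ sobolevBall r N

/-- The intersection points of two curves, as points of the plane. -/
def intersectionPoints {N : ℕ} (p : TrigCurve N × TrigCurve N) : Set (ℝ × ℝ) :=
  range (TrigCurve.eval p.1) ∩ range (TrigCurve.eval p.2)

/-- The intersection points of two curves, as pairs `(φ, ψ)` of points of the source circles
(represented by `[0, 2π)`) with the same image. -/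
def intersectionParams {N : ℕ} (p : TrigCurve N × TrigCurve N) : Set (ℝ × ℝ) :=
  {t | t.1 ∈ Ico 0 (2 * Real.pi) ∧ t.2 ∈ Ico 0 (2 * Real.pi) ∧
    TrigCurve.eval p.1 t.1 = TrigCurve.eval p.2 t.2}

/-- The set of pairs of curves from the unit ball with exactly `i` intersection points. -/
def pairsWithIntersections (r N i : ℕ) : Set (TrigCurve N × TrigCurve N) :=
  {p ∈ sobolevBallSq r N | (intersectionPoints p).encard = i}

/-- The relative volume of the set of pairs with exactly `i` intersection points. It is the same for
all translation-invariant volumes `vol`, one of which is the Euclidean volume of the `W₂ʳ` metric. -/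
def relVolume (r N : ℕ) (vol : Measure (TrigCurve N × TrigCurve N)) (i : ℕ) : ℝ :=
  vol.real (pairsWithIntersections r N i) / vol.real (sobolevBallSq r N)

/-- `τ_j = 1 + j² + ⋯ + j^{2r}`. -/
def tauNum (r j : ℕ) : ℝ := ∑ q ∈ Finset.range (r + 1), (j : ℝ) ^ (2 * q)

/-- `μ(N) = 1 + 2 ∑_{j=1}^N 1 / τ_j`. -/
def muNum (r N : ℕ) : ℝ := 1 + 2 * ∑ j ∈ Finset.Icc 1 N, 1 / tauNum r j

/-- `λ_r(N) = (∑_{j=1}^N j² / τ_j)^{1/2}`. -/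
def lambdaNum (r N : ℕ) : ℝ := Real.sqrt (∑ j ∈ Finset.Icc 1 N, (j : ℝ) ^ 2 / tauNum r j)

end

/-! The mean is computed by a Kac–Rice argument. If `f` is translated by a constant `a`, the
solutions of `f(φ) + a = g(ψ)` are the preimages of `a` under `(φ, ψ) ↦ g(ψ) - f(φ)`. The area
formula with multiplicities (`lintegral_mul_encard_preimage`), applied after averaging over
translations (`lintegral_eq_lintegral_translates`), expresses the total number of solutions as an
integral over `(φ, ψ)` of `|f'(φ) × g'(ψ)|` over pairs with `f(φ) = g(ψ)`
(`lintegral_encard_intersectionParams`). Conditioning on this null event is avoided: the first curve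
is translated into position, and each translation orbit is normalized by the indicator of the
constant term lying in the unit square.

At every `φ`, value and derivative are orthogonal functionals of norms `√(μ/2)` and `λ`, because
`cos² + sin² = 1` (`exists_adapted_coordinates`). Divided by these norms, position and velocity of a
curve in the ball therefore have density proportional to `(1 - |w|²)₊^(2N-1)`, the volume of a ball
in the remaining `4N - 2` dimensions (`exists_lintegral_sobolevBall_eq`). For two jets with a common
position, the integral of the cross product of the velocities reduces in polar coordinates to Beta
integrals (`lintegral_jetDensity_mul_cross`). Undoing the normalization contributes `2λ²/μ`, the
torus contributes `(2π)²`, and the unknown Jacobians cancel against the volume of the ball.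

Parameters may be replaced by points because almost surely no double point of one curve lies on the
other: the exceptional pairs lie in the image of a differentiable map with everywhere singular
derivative (`volume_double_point_on_curve`). Almost sure finiteness follows from the finite mean,
and measurability from `measurable_encard_of_hits`. -/

noncomputable section

/-! ### Fourier polynomials, their derivatives and the Sobolev energy -/

namespace FourierPoly

variable {N : ℕ}

/-- The coefficients of the derivative of a Fourier polynomial. -/
def derivCoeff (p : FourierPoly N) : FourierPoly N :=
  (Fin.cons 0 fun j : Fin N => ((j : ℕ) + 1 : ℝ) * p.2 j,
    fun j : Fin N => -((j : ℕ) + 1 : ℝ) * p.1 j.succ)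

/-- The term of frequency `j + 1` of a Fourier polynomial. -/
def harmonic (p : FourierPoly N) (j : Fin N) (φ : ℝ) : ℝ :=
  p.1 j.succ * Real.cos (((j : ℕ) + 1 : ℝ) * φ) + p.2 j * Real.sin (((j : ℕ) + 1 : ℝ) * φ)

lemma eval_eq (p : FourierPoly N) (φ : ℝ) : eval p φ = p.1 0 + ∑ j, harmonic p j φ := by
  simp [eval, harmonic, Fin.sum_univ_succ, Finset.sum_add_distrib, add_assoc]

lemma hasDerivAt_eval (p : FourierPoly N) (φ : ℝ) :
    HasDerivAt (eval p) (eval (derivCoeff p) φ) φ := by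
  have h (j : Fin N) : HasDerivAt (harmonic p j) (harmonic (derivCoeff p) j φ) φ := by
    have h0 : HasDerivAt (fun x : ℝ => ((j : ℕ) + 1 : ℝ) * x) ((j : ℕ) + 1 : ℝ) φ := by
      simpa using (hasDerivAt_id φ).const_mul ((j : ℕ) + 1 : ℝ)
    refine (((h0.cos).const_mul (p.1 j.succ)).add ((h0.sin).const_mul (p.2 j))).congr_deriv ?_
    simp only [harmonic, derivCoeff, Fin.cons_succ]
    ring
  have hs : HasDerivAt (fun x => p.1 0 + ∑ j, harmonic p j x)
      (∑ j, harmonic (derivCoeff p) j φ) φ :=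
    (HasDerivAt.fun_sum fun j _ => h j).const_add _
  have he : eval p = fun x => p.1 0 + ∑ j, harmonic p j x := funext (eval_eq p)
  rw [he, eval_eq]
  simpa [derivCoeff] using hs

lemma iteratedDeriv_eval (p : FourierPoly N) (q : ℕ) :
    iteratedDeriv q (eval p) = eval (derivCoeff^[q] p) := by
  induction q with
  | zero => simp
  | succ q ih =>
    rw [iteratedDeriv_succ, ih, Function.iterate_succ_apply']
    exact funext fun φ => (hasDerivAt_eval _ φ).deriv

lemma continuous_eval (p : FourierPoly N) : Continuous (eval p) :=
  continuous_iff_continuousAt.2 fun φ => (hasDerivAt_eval p φ).continuousAt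

lemma periodic_eval (p : FourierPoly N) : Function.Periodic (eval p) (2 * Real.pi) := by
  intro φ
  have h (j : Fin N) : ((j : ℕ) + 1 : ℝ) * (φ + 2 * Real.pi)
      = ((j : ℕ) + 1 : ℝ) * φ + ((j + 1 : ℕ) : ℝ) * (2 * Real.pi) := by push_cast; ring
  simp only [eval_eq, harmonic, h, Real.cos_add_nat_mul_two_pi, Real.sin_add_nat_mul_two_pi]

end FourierPoly

lemma integral_cos_int_mul (k : ℤ) :
    ∫ φ in (0 : ℝ)..(2 * Real.pi), Real.cos (k * φ) = if k = 0 then 2 * Real.pi else 0 := by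
  split_ifs with h
  · simp [h]
  · have hk : (k : ℝ) ≠ 0 := by exact_mod_cast h
    rw [intervalIntegral.integral_comp_mul_left _ hk]
    have : Real.sin (k * (2 * Real.pi)) = 0 := by
      have := Real.sin_int_mul_pi (2 * k)
      push_cast at this
      rw [← this]; ring_nf
    simp [this]

lemma integral_sin_int_mul (k : ℤ) :
    ∫ φ in (0 : ℝ)..(2 * Real.pi), Real.sin (k * φ) = 0 := by
  by_cases h : k = 0
  · simp [h]
  · have hk : (k : ℝ) ≠ 0 := by exact_mod_cast h
    rw [intervalIntegral.integral_comp_mul_left _ hk]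
    simp [Real.cos_int_mul_two_pi]

namespace FourierPoly

variable {N : ℕ}

lemma continuous_harmonic (p : FourierPoly N) (j : Fin N) : Continuous (harmonic p j) := by
  unfold harmonic; fun_prop

lemma integral_harmonic (p : FourierPoly N) (j : Fin N) :
    ∫ φ in (0 : ℝ)..(2 * Real.pi), harmonic p j φ = 0 := by
  have hc := integral_cos_int_mul (j + 1)
  have hs := integral_sin_int_mul (j + 1)
  have hj : ((j : ℕ) : ℤ) + 1 ≠ 0 := by positivity
  push_cast at hc hs
  simp only [hj, if_false] at hc
  unfold harmonic
  rw [intervalIntegral.integral_add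
    (Continuous.intervalIntegrable (by fun_prop) _ _)
    (Continuous.intervalIntegrable (by fun_prop) _ _),
    intervalIntegral.integral_const_mul, intervalIntegral.integral_const_mul, hc, hs]
  simp

lemma integral_harmonic_mul (p : FourierPoly N) (i j : Fin N) :
    ∫ φ in (0 : ℝ)..(2 * Real.pi), harmonic p i φ * harmonic p j φ =
      if i = j then Real.pi * (p.1 j.succ ^ 2 + p.2 j ^ 2) else 0 := by
  have hc1 := integral_cos_int_mul ((i : ℤ) - j)
  have hc2 := integral_cos_int_mul ((i : ℤ) + j + 2)
  have hs1 := integral_sin_int_mul ((i : ℤ) - j)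
  have hs2 := integral_sin_int_mul ((i : ℤ) + j + 2)
  -- Frequencies are stored shifted by one, so the sum frequency is `i + j + 2` and never vanishes.
  have hj : ((i : ℕ) : ℤ) + j + 2 ≠ 0 := by positivity
  have hij : ((i : ℕ) : ℤ) - j = 0 ↔ i = j := by rw [sub_eq_zero, Nat.cast_inj, Fin.val_inj]
  simp only [hj, if_false] at hc2
  simp only [hij] at hc1
  push_cast at hc1 hc2 hs1 hs2
  have hprod : ∀ φ : ℝ, harmonic p i φ * harmonic p j φ =
      ((p.1 i.succ * p.1 j.succ + p.2 i * p.2 j) / 2) * Real.cos (((i : ℕ) - (j : ℕ) : ℝ) * φ) +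
      ((p.1 i.succ * p.1 j.succ - p.2 i * p.2 j) / 2) *
        Real.cos (((i : ℕ) + (j : ℕ) + 2 : ℝ) * φ) +
      (((p.2 i * p.1 j.succ - p.1 i.succ * p.2 j) / 2) *
        Real.sin (((i : ℕ) - (j : ℕ) : ℝ) * φ) +
      ((p.2 i * p.1 j.succ + p.1 i.succ * p.2 j) / 2) *
        Real.sin (((i : ℕ) + (j : ℕ) + 2 : ℝ) * φ)) := by
    intro φ
    have e1 : ((i : ℕ) - (j : ℕ) : ℝ) * φ = ((i : ℕ) + 1 : ℝ) * φ - ((j : ℕ) + 1 : ℝ) * φ := by ring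
    have e2 : ((i : ℕ) + (j : ℕ) + 2 : ℝ) * φ = ((i : ℕ) + 1 : ℝ) * φ + ((j : ℕ) + 1 : ℝ) * φ := by
      ring
    rw [e1, e2, Real.cos_sub, Real.cos_add, Real.sin_sub, Real.sin_add]
    unfold harmonic
    ring
  simp only [hprod]
  rw [intervalIntegral.integral_add
    (Continuous.intervalIntegrable (by fun_prop) _ _)
    (Continuous.intervalIntegrable (by fun_prop) _ _),
    intervalIntegral.integral_add
    (Continuous.intervalIntegrable (by fun_prop) _ _)
    (Continuous.intervalIntegrable (by fun_prop) _ _),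
    intervalIntegral.integral_add
    (Continuous.intervalIntegrable (by fun_prop) _ _)
    (Continuous.intervalIntegrable (by fun_prop) _ _)]
  simp only [intervalIntegral.integral_const_mul]
  rw [hc1, hc2, hs1, hs2]
  split_ifs with h
  · subst h; ring
  · ring

/-- Orthogonality of the harmonics. The constant contributes `2π` and every other basis function
`π`, which is the origin of the weight `2` on `p.1 0` in the energy. -/
lemma integral_eval_sq (p : FourierPoly N) :
    ∫ φ in (0 : ℝ)..(2 * Real.pi), eval p φ * eval p φ =
      Real.pi * (2 * p.1 0 ^ 2 + ∑ j : Fin N, (p.1 j.succ ^ 2 + p.2 j ^ 2)) := by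
  have hexp : ∀ φ, eval p φ * eval p φ = p.1 0 ^ 2 + (2 * p.1 0) * ∑ j, harmonic p j φ +
      ∑ i, ∑ j, harmonic p i φ * harmonic p j φ := by
    intro φ
    rw [eval_eq, ← Finset.sum_mul_sum]; ring
  have hch := continuous_harmonic p
  have i1 : IntervalIntegrable (fun φ => ∑ j, harmonic p j φ) volume 0 (2 * Real.pi) :=
    (continuous_finsetSum _ fun j _ => hch j).intervalIntegrable _ _
  simp only [hexp]
  rw [intervalIntegral.integral_add, intervalIntegral.integral_add,
    intervalIntegral.integral_const_mul, intervalIntegral.integral_finsetSum,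
    intervalIntegral.integral_finsetSum]
  · have : ∀ i, ∫ φ in (0 : ℝ)..(2 * Real.pi), ∑ j, harmonic p i φ * harmonic p j φ =
        Real.pi * (p.1 i.succ ^ 2 + p.2 i ^ 2) := by
      intro i
      rw [intervalIntegral.integral_finsetSum]
      · simp [integral_harmonic_mul]
      · intro j _
        exact ((hch i).mul (hch j)).intervalIntegrable _ _
    rw [Finset.sum_congr rfl fun i _ => this i, ← Finset.mul_sum]
    simp only [integral_harmonic]
    simp
    ring
  · intro i _
    exact (continuous_finsetSum _ fun j _ => (hch i).mul (hch j)).intervalIntegrable _ _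
  · intro j _
    exact (hch j).intervalIntegrable _ _
  · simp
  · exact i1.const_mul _
  · exact (IntervalIntegrable.add (by simp) (i1.const_mul _))
  · exact (continuous_finsetSum _ fun i _ => continuous_finsetSum _ fun j _ =>
      (hch i).mul (hch j)).intervalIntegrable _ _

/-- Differentiation rotates the coefficient pair of a frequency by a right angle and multiplies it
by that frequency. -/
lemma derivCoeff_iterate_sq (p : FourierPoly N) (q : ℕ) (j : Fin N) :
    (derivCoeff^[q] p).1 j.succ ^ 2 + (derivCoeff^[q] p).2 j ^ 2 =
      ((j : ℕ) + 1 : ℝ) ^ (2 * q) * (p.1 j.succ ^ 2 + p.2 j ^ 2) := by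
  induction q with
  | zero => simp
  | succ q ih =>
    rw [Function.iterate_succ_apply', Nat.mul_succ, pow_add, mul_assoc, mul_left_comm, ← ih]
    simp only [derivCoeff, Fin.cons_succ]
    ring

lemma derivCoeff_iterate_zero (p : FourierPoly N) (q : ℕ) :
    (derivCoeff^[q] p).1 0 ^ 2 = if q = 0 then p.1 0 ^ 2 else 0 := by
  cases q with
  | zero => simp
  | succ q => rw [Function.iterate_succ_apply']; simp [derivCoeff]

/-- The square of the `W₂ʳ` norm of a Fourier polynomial. -/
def energy (r : ℕ) (p : FourierPoly N) : ℝ :=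
  2 * p.1 0 ^ 2 + ∑ j : Fin N, tauNum r (j + 1) * (p.1 j.succ ^ 2 + p.2 j ^ 2)

lemma sum_integral_iteratedDeriv_sq (r : ℕ) (p : FourierPoly N) :
    ∑ q ∈ Finset.range (r + 1), ∫ φ in (0 : ℝ)..(2 * Real.pi),
      iteratedDeriv q (eval p) φ * iteratedDeriv q (eval p) φ = Real.pi * energy r p := by
  simp only [iteratedDeriv_eval, integral_eval_sq, derivCoeff_iterate_sq, derivCoeff_iterate_zero,
    ← Finset.mul_sum, Finset.sum_add_distrib, energy, tauNum]
  rw [Finset.sum_comm]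
  simp [Finset.sum_mul]

end FourierPoly

open FourierPoly

lemma sobolevDot_self (r : ℕ) {N : ℕ} (f : TrigCurve N) :
    sobolevDot r f f = energy r f.1 + energy r f.2 := by
  have hc (p : FourierPoly N) (q : ℕ) : Continuous fun φ =>
      iteratedDeriv q (eval p) φ * iteratedDeriv q (eval p) φ := by
    rw [iteratedDeriv_eval]
    exact (continuous_eval _).mul (continuous_eval _)
  unfold sobolevDot
  rw [intervalIntegral.integral_finsetSum]
  swap
  · exact fun q _ => ((hc f.1 q).add (hc f.2 q)).intervalIntegrable _ _
  simp only [intervalIntegral.integral_add ((hc f.1 _).intervalIntegrable _ _)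
    ((hc f.2 _).intervalIntegrable _ _), Finset.sum_add_distrib, sum_integral_iteratedDeriv_sq]
  field_simp

lemma mem_sobolevBall {r N : ℕ} {f : TrigCurve N} :
    f ∈ sobolevBall r N ↔ energy r f.1 + energy r f.2 ≤ 1 := by
  simp [sobolevBall, sobolevNorm, sobolevDot_self, Real.sqrt_le_left]

lemma continuous_energy (r N : ℕ) : Continuous (energy r : FourierPoly N → ℝ) := by
  unfold energy; fun_prop

lemma isClosed_sobolevBall (r N : ℕ) : IsClosed (sobolevBall r N) := by
  have : sobolevBall r N = {f | energy r f.1 + energy r f.2 ≤ 1} := by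
    ext; exact mem_sobolevBall
  rw [this]
  have := continuous_energy r N
  exact isClosed_le (by fun_prop) continuous_const

lemma FourierPoly.continuous_eval_prod {N : ℕ} :
    Continuous fun z : FourierPoly N × ℝ => eval z.1 z.2 := by
  unfold eval; fun_prop

/-! ### The area formula with multiplicities -/

/-- A measurable set on which a strictly differentiable map has invertible derivatives splits into
countably many measurable pieces on which the map is injective. -/
lemma exists_partition_injOn {E : Type*} [NormedAddCommGroup E] [NormedSpace ℝ E]
    [FiniteDimensional ℝ E] [MeasurableSpace E] [BorelSpace E] {F : E → E} {F' : E → E →L[ℝ] E}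
    (hF : ∀ x, HasStrictFDerivAt F (F' x) x) {S : Set E} (hS : MeasurableSet S)
    (hdet : ∀ x ∈ S, (F' x).det ≠ 0) :
    ∃ T : ℕ → Set E, (∀ n, MeasurableSet (T n)) ∧ Pairwise (Function.onFun Disjoint T) ∧
      ⋃ n, T n = S ∧ ∀ n, InjOn F (T n) := by
  have hloc : ∀ x, ∃ U : Set E, IsOpen U ∧ x ∈ U ∧ (x ∈ S → InjOn F U) := by
    intro x
    by_cases hx : x ∈ S
    -- The inverse function theorem gives an open set of injectivity around each point of `S`.
    · have hs : HasStrictFDerivAt F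
          (((F' x).toContinuousLinearEquivOfDetNeZero (hdet x hx) : E ≃L[ℝ] E) : E →L[ℝ] E) x := by
        simpa using hF x
      refine ⟨(hs.toOpenPartialHomeomorph F).source, (hs.toOpenPartialHomeomorph F).open_source,
        hs.mem_toOpenPartialHomeomorph_source, fun _ => ?_⟩
      have := (hs.toOpenPartialHomeomorph F).injOn
      simpa using this
    · exact ⟨univ, isOpen_univ, mem_univ x, fun h => absurd h hx⟩
  choose U hUo hxU hUinj using hloc
  obtain ⟨t, htS, htc, hcov⟩ : ∃ t ⊆ S, t.Countable ∧ S ⊆ ⋃ x ∈ t, U x :=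
    TopologicalSpace.countable_cover_nhdsWithin
      fun x _ => mem_nhdsWithin_of_mem_nhds ((hUo x).mem_nhds (hxU x))
  rcases t.eq_empty_or_nonempty with rfl | hne
  · have : S = ∅ := by simpa using hcov
    refine ⟨fun _ => ∅, by simp, fun i j _ => by simp [Function.onFun], by simp [this], by simp⟩
  · obtain ⟨e, rfl⟩ := htc.exists_eq_range hne
    refine ⟨disjointed fun n => U (e n) ∩ S, fun n => ?_, disjoint_disjointed _, ?_, fun n => ?_⟩
    · exact MeasurableSet.disjointed (fun n => (hUo _).measurableSet.inter hS) n
    · rw [iUnion_disjointed, ← iUnion_inter]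
      exact inter_eq_right.2 (by simpa using hcov)
    · exact (hUinj (e n) (htS ⟨n, rfl⟩)).mono
        ((disjointed_subset _ n).trans inter_subset_left)

/-- The area formula with multiplicities for a `C¹` map between spaces of the same dimension. -/
theorem lintegral_mul_encard_preimage {E : Type*} [NormedAddCommGroup E] [NormedSpace ℝ E]
    [FiniteDimensional ℝ E] [MeasurableSpace E] [BorelSpace E] (μ : Measure E)
    [μ.IsAddHaarMeasure] {F : E → E} {F' : E → E →L[ℝ] E}
    (hF : ∀ x, HasStrictFDerivAt F (F' x) x) (hF' : Continuous F') {S : Set E}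
    (hS : MeasurableSet S) {h : E → ENNReal} (hh : Measurable h) :
    ∫⁻ a, h a * ((S ∩ F ⁻¹' {a}).encard : ENNReal) ∂μ =
      ∫⁻ t in S, ENNReal.ofReal |(F' t).det| * h (F t) ∂μ := by
  have hdetc : Continuous fun t => (F' t).det := ContinuousLinearMap.continuous_det.comp hF'
  set Z : Set E := {t | (F' t).det = 0} with hZ
  have hZm : MeasurableSet Z := (isClosed_eq hdetc continuous_const).measurableSet
  have hFc : Continuous F :=
    continuous_iff_continuousAt.2 fun x => (hF x).hasFDerivAt.continuousAt
  obtain ⟨T, hTm, hTd, hTU, hTi⟩ := exists_partition_injOn hF (hS.diff hZm) (fun x hx => hx.2)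
  -- Sard's theorem in equal dimensions: values taken at critical points can be discarded, and every
  -- remaining preimage lies in exactly one of the pieces `T n`.
  have hnull : μ (F '' Z) = 0 :=
    addHaar_image_eq_zero_of_det_fderivWithin_eq_zero μ
      (fun x _ => (hF x).hasFDerivAt.hasFDerivWithinAt) fun x hx => hx
  have hcount : ∀ a ∉ F '' Z, ((S ∩ F ⁻¹' {a}).encard : ENNReal) =
      ∑' n, (F '' T n).indicator 1 a := by
    intro a ha
    have h1 : S ∩ F ⁻¹' {a} = ⋃ n, T n ∩ F ⁻¹' {a} := by
      rw [← iUnion_inter, hTU]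
      ext t
      simp only [mem_inter_iff, mem_preimage, mem_singleton_iff, mem_sdiff]
      refine ⟨fun ⟨h1, h2⟩ => ⟨⟨h1, fun hz => ha ⟨t, hz, h2⟩⟩, h2⟩, fun ⟨h1, h2⟩ => ⟨h1.1, h2⟩⟩
    rw [h1, ← Measure.count_apply (MeasurableSet.iUnion fun n =>
      (hTm n).inter (hFc.measurable (measurableSet_singleton a))), measure_iUnion]
    · refine tsum_congr fun n => ?_
      rw [Measure.count_apply ((hTm n).inter (hFc.measurable (measurableSet_singleton a)))]
      by_cases hn : a ∈ F '' T n
      · obtain ⟨t, ht, rfl⟩ := hn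
        have : T n ∩ F ⁻¹' {F t} = {t} := by
          ext s
          simp only [mem_inter_iff, mem_preimage, mem_singleton_iff]
          exact ⟨fun ⟨h1, h2⟩ => hTi n h1 ht h2, by rintro rfl; exact ⟨ht, rfl⟩⟩
        rw [this, indicator_of_mem (mem_image_of_mem F ht)]
        simp
      · have : T n ∩ F ⁻¹' {a} = ∅ := by
          ext s
          simp only [mem_inter_iff, mem_preimage, mem_singleton_iff, mem_empty_iff_false, iff_false]
          exact fun ⟨h1, h2⟩ => hn ⟨s, h1, h2⟩
        rw [this, indicator_of_notMem hn]
        simp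
    · exact fun i j hij => (hTd hij).mono inter_subset_left inter_subset_left
    · exact fun n => (hTm n).inter (hFc.measurable (measurableSet_singleton a))
  have himg (n : ℕ) : MeasurableSet (F '' T n) :=
    measurable_image_of_fderivWithin (hTm n)
      (fun x _ => (hF x).hasFDerivAt.hasFDerivWithinAt) (hTi n)
  calc ∫⁻ a, h a * ((S ∩ F ⁻¹' {a}).encard : ENNReal) ∂μ
      = ∫⁻ a, ∑' n, (F '' T n).indicator h a ∂μ := by
        refine lintegral_congr_ae ?_
        filter_upwards [measure_eq_zero_iff_ae_notMem.1 hnull] with a ha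
        rw [hcount a ha, ← ENNReal.tsum_mul_left]
        refine tsum_congr fun n => ?_
        by_cases hn : a ∈ F '' T n <;> simp [hn]
    _ = ∑' n, ∫⁻ a in F '' T n, h a ∂μ := by
        rw [lintegral_tsum fun n => (hh.indicator (himg n)).aemeasurable]
        exact tsum_congr fun n => lintegral_indicator (himg n) h
    _ = ∑' n, ∫⁻ t in T n, ENNReal.ofReal |(F' t).det| * h (F t) ∂μ :=
        tsum_congr fun n => lintegral_image_eq_lintegral_abs_det_fderiv_mul μ (hTm n)
          (fun x _ => (hF x).hasFDerivAt.hasFDerivWithinAt) (hTi n) h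
    _ = ∫⁻ t in S \ Z, ENNReal.ofReal |(F' t).det| * h (F t) ∂μ := by
        rw [← hTU, lintegral_iUnion hTm hTd]
    _ = ∫⁻ t in S, ENNReal.ofReal |(F' t).det| * h (F t) ∂μ := by
        rw [← lintegral_inter_add_sdiff _ S hZm]
        have : ∫⁻ t in S ∩ Z, ENNReal.ofReal |(F' t).det| * h (F t) ∂μ = 0 := by
          rw [setLIntegral_congr_fun (g := fun _ => 0) (hS.inter hZm)]
          · simp
          · intro t ht
            have : (F' t).det = 0 := ht.2
            simp [this]
        rw [this, zero_add]

/-! ### Measurability of the cardinality of a random set -/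

/-- The cardinality of a random set that hits open sets measurably is measurable. -/
lemma measurable_encard_of_hits {Ω X : Type*} [MeasurableSpace Ω] [TopologicalSpace X] [T2Space X]
    [SecondCountableTopology X] {Z : Ω → Set X}
    (hZ : ∀ U, IsOpen U → MeasurableSet {p | (Z p ∩ U).Nonempty}) (k : ℕ) :
    MeasurableSet {p | (k : ℕ∞) ≤ (Z p).encard} := by
  set b := TopologicalSpace.countableBasis X
  have hb := TopologicalSpace.isBasis_countableBasis X
  -- A Hausdorff space allows `k` points to be separated by pairwise disjoint basic open sets; as
  -- the basis is countable, only countably many `k`-tuples occur.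
  have : {p | (k : ℕ∞) ≤ (Z p).encard} =
      ⋃ U ∈ {U : Fin k → b | Pairwise fun i j => Disjoint (U i : Set X) (U j)},
        ⋂ i, {p | (Z p ∩ (U i : Set X)).Nonempty} := by
    ext p
    simp only [mem_ofPred_eq, mem_iUnion, mem_iInter, exists_prop]
    constructor
    · intro hk
      obtain ⟨t, htZ, htk⟩ := exists_subset_encard_eq hk
      have htf : t.Finite := finite_of_encard_eq_coe htk
      obtain ⟨V, hV, hVd⟩ := htf.t2_separation
      have : ∀ x, ∃ u : b, x ∈ (u : Set X) ∧ (u : Set X) ⊆ V x := fun x => by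
        obtain ⟨u, hu, hx, hs⟩ := hb.exists_subset_of_mem_open (hV x).1 (hV x).2
        exact ⟨⟨u, hu⟩, hx, hs⟩
      choose W hW hWV using this
      have hcard : Nat.card t = k := by
        have := Nat.card_coe_set_eq t
        rw [this, ncard, htk]; simp
      have := htf.to_subtype
      let e : Fin k ≃ t := (Finite.equivFinOfCardEq hcard).symm
      refine ⟨fun i => W (e i), fun i j hij => ?_, fun i => ⟨e i, htZ (e i).2, hW _⟩⟩
      exact (hVd (e i).2 (e j).2 fun h => hij (e.injective (Subtype.ext h))).mono (hWV _) (hWV _)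
    · rintro ⟨U, hUd, hU⟩
      choose x hx using hU
      have hinj : Function.Injective x := by
        intro i j hij
        by_contra hne
        exact disjoint_left.1 (hUd hne) (hx i).2 (hij ▸ (hx j).2)
      calc (k : ℕ∞) = (range x).encard := by
            rw [← image_univ, hinj.encard_image]; simp
        _ ≤ _ := encard_le_encard (range_subset_iff.2 fun i => (hx i).1)
  rw [this]
  refine MeasurableSet.biUnion (to_countable _) fun U _ => MeasurableSet.iInter fun i => ?_
  exact hZ _ (TopologicalSpace.isOpen_of_mem_countableBasis (U i).2)

/-! ### Haar measures on the coefficient spaces, and the numbers `τ`, `μ`, `λ` -/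

lemma isAddHaarMeasure_volume_prod (E F : Type*) [NormedAddCommGroup E] [MeasureSpace E]
    [BorelSpace E] [SecondCountableTopology E] [(volume : Measure E).IsAddHaarMeasure]
    [SigmaFinite (volume : Measure E)] [NormedAddCommGroup F] [MeasureSpace F] [BorelSpace F]
    [SecondCountableTopology F] [(volume : Measure F).IsAddHaarMeasure]
    [SigmaFinite (volume : Measure F)] : (volume : Measure (E × F)).IsAddHaarMeasure :=
  inferInstanceAs ((volume : Measure E).prod (volume : Measure F)).IsAddHaarMeasure

instance isAddHaarMeasure_volume_pi_prod (k n : ℕ) :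
    (volume : Measure ((Fin k → ℝ) × (Fin n → ℝ))).IsAddHaarMeasure :=
  isAddHaarMeasure_volume_prod _ _

instance isAddHaarMeasure_volume_trigCurve (N : ℕ) :
    (volume : Measure (TrigCurve N)).IsAddHaarMeasure :=
  isAddHaarMeasure_volume_prod _ _

instance isAddHaarMeasure_volume_trigCurve_prod (N : ℕ) :
    (volume : Measure (TrigCurve N × TrigCurve N)).IsAddHaarMeasure :=
  isAddHaarMeasure_volume_prod _ _

instance isAddHaarMeasure_volume_jet_prod (k : ℕ) :
    (volume : Measure (((ℝ × ℝ) × (ℝ × ℝ)) × ((Fin k → ℝ) × (Fin k → ℝ)))).IsAddHaarMeasure :=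
  have : (volume : Measure (ℝ × ℝ)).IsAddHaarMeasure := isAddHaarMeasure_volume_prod _ _
  have : (volume : Measure ((ℝ × ℝ) × (ℝ × ℝ))).IsAddHaarMeasure :=
    isAddHaarMeasure_volume_prod _ _
  isAddHaarMeasure_volume_prod _ _

lemma tauNum_pos (r j : ℕ) : 0 < tauNum r j := by
  unfold tauNum
  rw [Finset.sum_range_succ']
  have : 0 ≤ ∑ k ∈ Finset.range r, (j : ℝ) ^ (2 * (k + 1)) := Finset.sum_nonneg fun k _ => by
    positivity
  simpa using by linarith

lemma sum_Icc_one_eq (N : ℕ) (F : ℕ → ℝ) :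
    ∑ j ∈ Finset.Icc 1 N, F j = ∑ j : Fin N, F ((j : ℕ) + 1) := by
  rw [Fin.sum_univ_eq_sum_range (fun j => F (j + 1)), Finset.range_eq_Ico,
    Finset.sum_Ico_add' F 0 N 1]
  rfl

lemma muNum_eq (r N : ℕ) : muNum r N / 2 = 1 / 2 + ∑ j : Fin N, 1 / tauNum r (j + 1) := by
  rw [muNum, sum_Icc_one_eq N fun j => 1 / tauNum r j]; ring

lemma muNum_pos (r N : ℕ) : 0 < muNum r N := by
  unfold muNum
  have : 0 ≤ ∑ j ∈ Finset.Icc 1 N, 1 / tauNum r j :=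
    Finset.sum_nonneg fun j _ => (one_div_pos.2 (tauNum_pos r j)).le
  linarith

lemma lambdaNum_sq (r N : ℕ) :
    lambdaNum r N ^ 2 = ∑ j : Fin N, ((j : ℕ) + 1 : ℝ) ^ 2 / tauNum r (j + 1) := by
  rw [lambdaNum, Real.sq_sqrt, sum_Icc_one_eq N fun j => (j : ℝ) ^ 2 / tauNum r j]
  · push_cast; rfl
  · exact Finset.sum_nonneg fun j _ => div_nonneg (by positivity) (tauNum_pos r j).le

lemma lambdaNum_pos (r M : ℕ) : 0 < lambdaNum r (M + 1) := by
  refine Real.sqrt_pos.2 (Finset.sum_pos (fun j hj => ?_) ⟨1, by simp⟩)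
  have : 0 < j := (Finset.mem_Icc.1 hj).1
  have := tauNum_pos r j
  positivity

/-! ### Coordinates adapted to value and derivative at a point -/

namespace FourierPoly

variable {N : ℕ}

/-- Coordinates in which the energy of a Fourier polynomial is the Euclidean norm squared. -/
def scaled (r : ℕ) : FourierPoly N →ₗ[ℝ] EuclideanSpace ℝ (Fin (N + 1) ⊕ Fin N) where
  toFun p := WithLp.toLp 2 (Sum.elim
    (Fin.cons (√2 * p.1 0) fun j : Fin N => √(tauNum r (j + 1)) * p.1 j.succ)
    (fun j : Fin N => √(tauNum r (j + 1)) * p.2 j))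
  map_add' p q := by
    ext (i | i)
    · refine Fin.cases ?_ (fun j => ?_) i <;> simp [mul_add]
    · simp [mul_add]
  map_smul' c p := by
    ext (i | i)
    · refine Fin.cases ?_ (fun j => ?_) i <;> simp [mul_left_comm]
    · simp [mul_left_comm]

/-- The scaled coefficients of the functional `p ↦ p.1 0 * c + ∑ j, (p.1 (j + 1) * a j + p.2 j * b j)`. -/
def scaledDual (r : ℕ) (c : ℝ) (a b : Fin N → ℝ) : EuclideanSpace ℝ (Fin (N + 1) ⊕ Fin N) :=
  WithLp.toLp 2 (Sum.elim
    (Fin.cons (c / √2) fun j : Fin N => a j / √(tauNum r (j + 1)))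
    (fun j : Fin N => b j / √(tauNum r (j + 1))))

lemma norm_scaled_sq (r : ℕ) (p : FourierPoly N) : ‖scaled r p‖ ^ 2 = energy r p := by
  rw [EuclideanSpace.norm_sq_eq]
  simp only [scaled, LinearMap.coe_mk, AddHom.coe_mk, Fintype.sum_sum_type, Sum.elim_inl,
    Sum.elim_inr, Fin.sum_univ_succ, Fin.cons_zero, Fin.cons_succ, Real.norm_eq_abs, sq_abs,
    mul_pow, Real.sq_sqrt (tauNum_pos r _).le, Real.sq_sqrt zero_le_two, energy, mul_add,
    Finset.sum_add_distrib, add_assoc]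

lemma inner_scaledDual_scaled (r : ℕ) (c : ℝ) (a b : Fin N → ℝ) (p : FourierPoly N) :
    inner ℝ (scaledDual r c a b) (scaled r p) =
      c * p.1 0 + ∑ j, (a j * p.1 j.succ + b j * p.2 j) := by
  have h (j : ℕ) : √(tauNum r j) ≠ 0 := (Real.sqrt_pos.2 (tauNum_pos r j)).ne'
  have e (x y : ℝ) (j : ℕ) : √(tauNum r j) * x * (y / √(tauNum r j)) = y * x := by
    have := h j
    field_simp
  have e2 (x y : ℝ) : √2 * x * (y / √2) = y * x := by field_simp
  simp only [PiLp.inner_apply, scaled, scaledDual, LinearMap.coe_mk, AddHom.coe_mk,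
    Fintype.sum_sum_type, Sum.elim_inl, Sum.elim_inr, Fin.sum_univ_succ, Fin.cons_zero,
    Fin.cons_succ, RCLike.inner_apply, conj_trivial, e, e2, Finset.sum_add_distrib, add_assoc]

lemma inner_scaledDual (r : ℕ) (c c' : ℝ) (a b a' b' : Fin N → ℝ) :
    inner ℝ (scaledDual r c a b) (scaledDual r c' a' b') =
      c * c' / 2 + ∑ j : Fin N, (a j * a' j + b j * b' j) / tauNum r (j + 1) := by
  have e (x y : ℝ) (j : ℕ) : x / √(tauNum r j) * (y / √(tauNum r j)) = y * x / tauNum r j := by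
    rw [div_mul_div_comm, Real.mul_self_sqrt (tauNum_pos r j).le, mul_comm]
  have e2 (x y : ℝ) : x / √2 * (y / √2) = y * x / 2 := by
    rw [div_mul_div_comm, Real.mul_self_sqrt zero_le_two, mul_comm]
  simp only [PiLp.inner_apply, scaledDual,
    Fintype.sum_sum_type, Sum.elim_inl, Sum.elim_inr, Fin.sum_univ_succ, Fin.cons_zero,
    Fin.cons_succ, RCLike.inner_apply, conj_trivial, e, e2, Finset.sum_add_distrib, add_assoc,
    add_div]

/-- Linear coordinates on Fourier polynomials in which the energy is a sum of squares and the first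
two coordinates are the normalized value and the normalized derivative at a given point. -/
lemma exists_adapted_coordinates (r M : ℕ) (φ : ℝ) :
    ∃ A : FourierPoly (M + 1) ≃L[ℝ] (ℝ × ℝ) × (Fin (2 * M + 1) → ℝ), ∀ p,
      energy r p = (A p).1.1 ^ 2 + (A p).1.2 ^ 2 + ∑ i, (A p).2 i ^ 2 ∧
      eval p φ = √(muNum r (M + 1) / 2) * (A p).1.1 ∧
      eval (derivCoeff p) φ = lambdaNum r (M + 1) * (A p).1.2 := by
  set α := √(muNum r (M + 1) / 2) with hα
  set l := lambdaNum r (M + 1) with hl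
  have hα2 : α ^ 2 = muNum r (M + 1) / 2 := Real.sq_sqrt (half_pos (muNum_pos r _)).le
  have hα0 : 0 < α := Real.sqrt_pos.2 (half_pos (muNum_pos r _))
  have hl0 : 0 < l := lambdaNum_pos r M
  let C : Fin (M + 1) → ℝ := fun j => Real.cos (((j : ℕ) + 1 : ℝ) * φ)
  let D : Fin (M + 1) → ℝ := fun j => Real.sin (((j : ℕ) + 1 : ℝ) * φ)
  have hCD : ∀ j, C j ^ 2 + D j ^ 2 = 1 := fun j => Real.cos_sq_add_sin_sq _
  -- `k0` and `k1` represent evaluation and differentiation at `φ`. They are orthogonal because the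
  -- terms `cos · (-sin)` and `sin · cos` cancel in each frequency.
  let k0 := scaledDual (N := M + 1) r 1 C D
  let k1 := scaledDual (N := M + 1) r 0 (fun j => -((j : ℕ) + 1 : ℝ) * D j)
    (fun j => ((j : ℕ) + 1 : ℝ) * C j)
  have h00 : inner ℝ k0 k0 = α ^ 2 := by
    rw [inner_scaledDual, hα2, muNum_eq]
    simp only [← sq, hCD]
    norm_num
  have h11 : inner ℝ k1 k1 = l ^ 2 := by
    rw [inner_scaledDual, lambdaNum_sq, zero_mul, zero_div, zero_add]
    refine Finset.sum_congr rfl fun j _ => ?_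
    congr 1
    linear_combination ((j : ℕ) + 1 : ℝ) ^ 2 * hCD j
  have h01 : inner ℝ k0 k1 = 0 := by
    rw [inner_scaledDual, mul_zero, zero_div, zero_add]
    refine Finset.sum_eq_zero fun j _ => ?_
    rw [div_eq_zero_iff]
    left; ring
  have hk0 : ∀ p, eval p φ = inner ℝ k0 (scaled r p) := by
    intro p
    rw [inner_scaledDual_scaled, eval_eq, one_mul]
    refine congrArg _ (Finset.sum_congr rfl fun j _ => ?_)
    simp only [harmonic, C, D]; ring
  have hk1 : ∀ p, eval (derivCoeff p) φ = inner ℝ k1 (scaled r p) := by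
    intro p
    rw [inner_scaledDual_scaled, eval_eq, zero_mul]
    simp only [derivCoeff, harmonic, Fin.cons_zero, Fin.cons_succ]
    refine congrArg _ (Finset.sum_congr rfl fun j _ => ?_)
    simp only [C, D]; ring
  -- The extension to an orthonormal basis keeps only the first two vectors; the zeros are
  -- placeholders.
  let v : Fin 2 ⊕ Fin (2 * M + 1) → EuclideanSpace ℝ (Fin (M + 1 + 1) ⊕ Fin (M + 1)) :=
    Sum.elim ![α⁻¹ • k0, l⁻¹ • k1] 0
  have hv : Orthonormal ℝ ((range Sum.inl).domRestrict v) := by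
    rw [orthonormal_iff_ite]
    rintro ⟨_, ⟨i, rfl⟩⟩ ⟨_, ⟨j, rfl⟩⟩
    have h10 : inner ℝ k1 k0 = 0 := by rw [real_inner_comm]; exact h01
    fin_cases i <;> fin_cases j <;>
      simp [v, domRestrict, inner_smul_left, inner_smul_right, h00, h01, h10, h11, -inner_self_eq_norm_sq_to_K]
    all_goals field_simp
  obtain ⟨b, hb⟩ := hv.exists_orthonormalBasis_extension_of_card_eq (by simp; ring)
  let A0 : FourierPoly (M + 1) →ₗ[ℝ] (ℝ × ℝ) × (Fin (2 * M + 1) → ℝ) :=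
    (((innerₛₗ ℝ (b (Sum.inl 0))).prod (innerₛₗ ℝ (b (Sum.inl 1)))).prod
      (LinearMap.pi fun i => innerₛₗ ℝ (b (Sum.inr i)))) ∘ₗ scaled r
  have hA0 : ∀ p, energy r p = (A0 p).1.1 ^ 2 + (A0 p).1.2 ^ 2 + ∑ i, (A0 p).2 i ^ 2 := by
    intro p
    rw [← norm_scaled_sq, ← b.sum_sq_norm_inner_right]
    simp [A0, Fintype.sum_sum_type]
  -- Definiteness of the energy makes `A0` injective, and the dimensions agree: `2 (M + 1) + 1 = 2 +
  -- (2 M + 1)`.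
  have henergy : ∀ p : FourierPoly (M + 1), energy r p = 0 → p = 0 := by
    intro p hp
    have hnn : ∀ j : Fin (M + 1), 0 ≤ tauNum r (j + 1) * (p.1 j.succ ^ 2 + p.2 j ^ 2) := fun j =>
      mul_nonneg (tauNum_pos r _).le (by positivity)
    unfold energy at hp
    have hs := Finset.sum_nonneg fun j (_ : j ∈ Finset.univ) => hnn j
    have h0 : p.1 0 = 0 := by nlinarith [sq_nonneg (p.1 0)]
    have hs0 : ∑ j : Fin (M + 1), tauNum r (j + 1) * (p.1 j.succ ^ 2 + p.2 j ^ 2) = 0 := by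
      nlinarith [sq_nonneg (p.1 0)]
    have hj : ∀ j : Fin (M + 1), p.1 j.succ ^ 2 + p.2 j ^ 2 = 0 := fun j => by
      have := (Finset.sum_eq_zero_iff_of_nonneg fun j _ => hnn j).1 hs0 j (Finset.mem_univ j)
      exact (mul_eq_zero.1 this).resolve_left (tauNum_pos r _).ne'
    have hj1 : ∀ j : Fin (M + 1), p.1 j.succ = 0 := fun j => by nlinarith [hj j, sq_nonneg (p.1 j.succ), sq_nonneg (p.2 j)]
    have hj2 : ∀ j : Fin (M + 1), p.2 j = 0 := fun j => by nlinarith [hj j, sq_nonneg (p.1 j.succ), sq_nonneg (p.2 j)]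
    exact Prod.ext (funext fun i => Fin.cases h0 hj1 i) (funext hj2)
  have hinj : Function.Injective A0 := by
    refine (injective_iff_map_eq_zero A0).2 fun p hp => henergy p ?_
    rw [hA0, hp]; simp
  refine ⟨(A0.linearEquivOfInjective hinj (by simp; ring)).toContinuousLinearEquiv,
    fun p => ⟨hA0 p, ?_, ?_⟩⟩
  · have : b (Sum.inl 0) = α⁻¹ • k0 := hb _ ⟨0, rfl⟩
    rw [hk0]
    change _ = α * inner ℝ (b (Sum.inl 0)) (scaled r p)
    rw [this, inner_smul_left, conj_trivial, mul_inv_cancel_left₀ hα0.ne']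
  · have : b (Sum.inl 1) = l⁻¹ • k1 := hb _ ⟨1, rfl⟩
    rw [hk1]
    change _ = l * inner ℝ (b (Sum.inl 1)) (scaled r p)
    rw [this, inner_smul_left, conj_trivial, mul_inv_cancel_left₀ hl0.ne']

end FourierPoly

/-! ### Joint distribution of position and velocity of a curve in the ball -/

open scoped Pointwise


/-- The velocity vector of a curve. -/
def TrigCurve.velocity {N : ℕ} (f : TrigCurve N) (φ : ℝ) : ℝ × ℝ :=
  (FourierPoly.eval (derivCoeff f.1) φ, FourierPoly.eval (derivCoeff f.2) φ)

/-- The Euclidean norm squared on pairs of plane vectors. -/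
def pairNormSq (w : (ℝ × ℝ) × (ℝ × ℝ)) : ℝ := w.1.1 ^ 2 + w.1.2 ^ 2 + (w.2.1 ^ 2 + w.2.2 ^ 2)

lemma continuous_pairNormSq : Continuous pairNormSq := by unfold pairNormSq; fun_prop

/-- The Euclidean norm squared on pairs of vectors of length `k`. -/
def coordNormSq {k : ℕ} (z : (Fin k → ℝ) × (Fin k → ℝ)) : ℝ := ∑ i, z.1 i ^ 2 + ∑ i, z.2 i ^ 2

lemma continuous_coordNormSq {k : ℕ} :
    Continuous (coordNormSq : (Fin k → ℝ) × (Fin k → ℝ) → ℝ) := by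
  unfold coordNormSq; fun_prop

lemma coordNormSq_smul {k : ℕ} (c : ℝ) (z : (Fin k → ℝ) × (Fin k → ℝ)) :
    coordNormSq (c • z) = c ^ 2 * coordNormSq z := by
  simp [coordNormSq, mul_pow, Finset.mul_sum, mul_add]

lemma norm_sq_le_coordNormSq {k : ℕ} (z : (Fin k → ℝ) × (Fin k → ℝ)) :
    ‖z‖ ^ 2 ≤ coordNormSq z := by
  have h (y : Fin k → ℝ) : ‖y‖ ^ 2 ≤ ∑ i, y i ^ 2 := by
    have : ‖y‖ ≤ √(∑ i, y i ^ 2) := (pi_norm_le_iff_of_nonneg (Real.sqrt_nonneg _)).2 fun i => by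
      rw [Real.norm_eq_abs]
      exact Real.abs_le_sqrt
        (Finset.single_le_sum (f := fun i => y i ^ 2) (fun i _ => sq_nonneg _) (Finset.mem_univ i))
    calc ‖y‖ ^ 2 ≤ √(∑ i, y i ^ 2) ^ 2 := by gcongr
      _ = _ := Real.sq_sqrt (Finset.sum_nonneg fun i _ => sq_nonneg _)
  have h1 := h z.1
  have h2 := h z.2
  have h3 : 0 ≤ ∑ i, z.1 i ^ 2 := Finset.sum_nonneg fun i _ => sq_nonneg _
  have h4 : 0 ≤ ∑ i, z.2 i ^ 2 := Finset.sum_nonneg fun i _ => sq_nonneg _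
  rw [Prod.norm_def, coordNormSq]
  rcases max_cases ‖z.1‖ ‖z.2‖ with h | h <;> rw [h.1] <;> linarith

/-- Homogeneity in dimension `2 k`: the radius is `√s`, so the volume scales by `s ^ k`. With `k ≠
0` the formula also covers `s ≤ 0`, where both sides vanish. -/
lemma volume_coordNormSq_le {k : ℕ} (hk : k ≠ 0) (s : ℝ) :
    volume {z : (Fin k → ℝ) × (Fin k → ℝ) | coordNormSq z ≤ s} =
      ENNReal.ofReal s ^ k * volume {z : (Fin k → ℝ) × (Fin k → ℝ) | coordNormSq z ≤ 1} := by
  rcases lt_or_ge 0 s with hs | hs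
  · have hset : {z : (Fin k → ℝ) × (Fin k → ℝ) | coordNormSq z ≤ s} =
        √s • {z : (Fin k → ℝ) × (Fin k → ℝ) | coordNormSq z ≤ 1} := by
      have h0 : √s ≠ 0 := (Real.sqrt_pos.2 hs).ne'
      ext z
      rw [mem_smul_set_iff_inv_smul_mem₀ h0, mem_ofPred_eq, mem_ofPred_eq, coordNormSq_smul,
        inv_pow, Real.sq_sqrt hs.le, inv_mul_le_iff₀ hs, mul_one]
    rw [hset, Measure.addHaar_smul]
    congr 1
    have : Module.finrank ℝ ((Fin k → ℝ) × (Fin k → ℝ)) = 2 * k := by simp; ring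
    rw [this, pow_mul, Real.sq_sqrt hs.le, abs_of_nonneg (by positivity),
      ENNReal.ofReal_pow hs.le]
  · rw [ENNReal.ofReal_of_nonpos hs, zero_pow hk, zero_mul]
    have hne : Nonempty (Fin k) := ⟨⟨0, Nat.pos_of_ne_zero hk⟩⟩
    have hsub : {z : (Fin k → ℝ) × (Fin k → ℝ) | coordNormSq z ≤ s} ⊆ {0} := by
      intro z hz
      have hz' : coordNormSq z ≤ s := hz
      have : ‖z‖ ^ 2 ≤ 0 := (norm_sq_le_coordNormSq z).trans (hz'.trans hs)
      have : ‖z‖ = 0 := by nlinarith [norm_nonneg z]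
      simpa using this
    have := Module.punctured_nhds_neBot ℝ ((Fin k → ℝ) × (Fin k → ℝ)) 0
    have := Measure.IsAddHaarMeasure.nullSingletonClass
      (volume : Measure ((Fin k → ℝ) × (Fin k → ℝ)))
    exact measure_mono_null hsub (measure_singleton _)

lemma volume_coordNormSq_ne_zero (k : ℕ) :
    volume {z : (Fin k → ℝ) × (Fin k → ℝ) | coordNormSq z ≤ 1} ≠ 0 := by
  have ho : IsOpen {z : (Fin k → ℝ) × (Fin k → ℝ) | coordNormSq z < 1} :=
    isOpen_lt continuous_coordNormSq continuous_const
  exact (ho.measure_pos volume ⟨0, by simp [coordNormSq]⟩).trans_le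
    (measure_mono fun z (hz : coordNormSq z < 1) => hz.le) |>.ne'

lemma volume_coordNormSq_ne_top (k : ℕ) :
    volume {z : (Fin k → ℝ) × (Fin k → ℝ) | coordNormSq z ≤ 1} ≠ ⊤ := by
  refine ((measure_mono fun z (hz : coordNormSq z ≤ 1) => ?_).trans_lt
    (isCompact_closedBall (0 : (Fin k → ℝ) × (Fin k → ℝ)) 1).measure_lt_top).ne
  rw [mem_closedBall_zero_iff]
  nlinarith [norm_sq_le_coordNormSq z, norm_nonneg z]

/-- The density, up to a constant, of the normalized position and velocity of a random curve. -/
def jetDensity (m : ℕ) (w : (ℝ × ℝ) × (ℝ × ℝ)) : ENNReal := ENNReal.ofReal (1 - pairNormSq w) ^ m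

lemma measurable_jetDensity (m : ℕ) : Measurable (jetDensity m) := by
  have := continuous_pairNormSq.measurable
  unfold jetDensity; fun_prop

/-- The distribution of position and velocity, at a given time, of a curve in the unit ball. -/
lemma exists_lintegral_sobolevBall_eq (r M : ℕ) (φ : ℝ) :
    ∃ C : ENNReal, C ≠ 0 ∧ C ≠ ⊤ ∧ ∀ G : (ℝ × ℝ) × (ℝ × ℝ) → ENNReal, Measurable G →
      ∫⁻ f in sobolevBall r (M + 1), G (TrigCurve.eval f φ, TrigCurve.velocity f φ) =
        C * ∫⁻ w, jetDensity (2 * M + 1) w *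
          G (√(muNum r (M + 1) / 2) • w.1, lambdaNum r (M + 1) • w.2) := by
  obtain ⟨A, hA⟩ := exists_adapted_coordinates r M φ
  set α := √(muNum r (M + 1) / 2)
  set l := lambdaNum r (M + 1)
  let k := 2 * M + 1
  -- The coordinates of `x` and `y` are regrouped as position, velocity, and the `2 k` remaining
  -- ones.
  let A' : TrigCurve (M + 1) ≃L[ℝ] ((ℝ × ℝ) × (ℝ × ℝ)) × ((Fin k → ℝ) × (Fin k → ℝ)) :=
    ((A.prodCongr A).trans (ContinuousLinearEquiv.prodProdProdComm ℝ (ℝ × ℝ) (Fin k → ℝ) (ℝ × ℝ)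
      (Fin k → ℝ))).trans
      ((ContinuousLinearEquiv.prodProdProdComm ℝ ℝ ℝ ℝ ℝ).prodCongr
        (ContinuousLinearEquiv.refl ℝ _))
  have hA' : ∀ f, A' f = ((((A f.1).1.1, (A f.2).1.1), ((A f.1).1.2, (A f.2).1.2)),
      ((A f.1).2, (A f.2).2)) := fun f => rfl
  have hball : ∀ f, f ∈ sobolevBall r (M + 1) ↔
      coordNormSq (A' f).2 ≤ 1 - pairNormSq (A' f).1 := by
    intro f
    rw [mem_sobolevBall, (hA f.1).1, (hA f.2).1, hA', coordNormSq, pairNormSq, le_sub_iff_add_le]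
    constructor <;> intro h <;> dsimp only at h ⊢ <;> linarith
  -- Uniqueness of Haar measure replaces the Jacobian of `A'` by a constant that need not be
  -- computed.
  have hmap := Measure.isAddLeftInvariant_eq_smul
    (Measure.map A' (volume : Measure (TrigCurve (M + 1)))) volume
  have hpos := Measure.addHaarScalarFactor_pos_of_isAddHaarMeasure
    (Measure.map A' (volume : Measure (TrigCurve (M + 1)))) volume
  set c := (Measure.map A' (volume : Measure (TrigCurve (M + 1)))).addHaarScalarFactor volume
  set ω := volume {z : (Fin k → ℝ) × (Fin k → ℝ) | coordNormSq z ≤ 1} with hω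
  refine ⟨c * ω, mul_ne_zero (by simpa using hpos.ne') (volume_coordNormSq_ne_zero k),
    ENNReal.mul_ne_top ENNReal.coe_ne_top (volume_coordNormSq_ne_top k), fun G hG => ?_⟩
  have hqc : Continuous fun y : ((ℝ × ℝ) × (ℝ × ℝ)) × ((Fin k → ℝ) × (Fin k → ℝ)) =>
      1 - pairNormSq y.1 := continuous_const.sub (continuous_pairNormSq.comp continuous_fst)
  let S : Set (((ℝ × ℝ) × (ℝ × ℝ)) × ((Fin k → ℝ) × (Fin k → ℝ))) :=
    {y | coordNormSq y.2 ≤ 1 - pairNormSq y.1}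
  have hS : MeasurableSet S :=
    (isClosed_le (continuous_coordNormSq.comp continuous_snd) hqc).measurableSet
  let H : ((ℝ × ℝ) × (ℝ × ℝ)) × ((Fin k → ℝ) × (Fin k → ℝ)) → ENNReal :=
    S.indicator fun y => G (α • y.1.1, l • y.1.2)
  have hH : Measurable H := by
    refine Measurable.indicator (hG.comp ?_) hS
    fun_prop
  calc ∫⁻ f in sobolevBall r (M + 1), G (TrigCurve.eval f φ, TrigCurve.velocity f φ)
      = ∫⁻ f, H (A' f) := by
        rw [← lintegral_indicator (isClosed_sobolevBall r _).measurableSet]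
        refine lintegral_congr fun f => ?_
        have hG' : G (TrigCurve.eval f φ, TrigCurve.velocity f φ) =
            G (α • (A' f).1.1, l • (A' f).1.2) := by
          rw [hA', TrigCurve.eval, TrigCurve.velocity, (hA f.1).2.1, (hA f.2).2.1, (hA f.1).2.2,
            (hA f.2).2.2]
          rfl
        by_cases hf : f ∈ sobolevBall r (M + 1)
        · have hS' : A' f ∈ S := (hball f).1 hf
          simp only [indicator_of_mem hf, hG', H, indicator_of_mem hS']
        · have hS' : A' f ∉ S := fun h => hf ((hball f).2 h)
          simp only [indicator_of_notMem hf, H, indicator_of_notMem hS']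
    _ = ∫⁻ y, H y ∂(Measure.map A' volume) := (lintegral_map hH A'.continuous.measurable).symm
    _ = c * ∫⁻ y, H y := by rw [hmap, lintegral_smul_measure]; rfl
    _ = c * ∫⁻ w, ∫⁻ z, H (w, z) := by
        rw [Measure.volume_eq_prod, lintegral_prod _ hH.aemeasurable]
    -- The fibre of the ball over the jet `w` is a ball of squared radius `1 - pairNormSq w`.
    _ = c * ∫⁻ w, ω * (jetDensity k w * G (α • w.1, l • w.2)) := by
        congr 1
        refine lintegral_congr fun w => ?_
        have : ∀ z, H (w, z) = {z | coordNormSq z ≤ 1 - pairNormSq w}.indicator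
            (fun _ => G (α • w.1, l • w.2)) z := fun z => rfl
        simp only [this]
        rw [lintegral_indicator_const
          (isClosed_le continuous_coordNormSq continuous_const).measurableSet,
          volume_coordNormSq_le (by omega), jetDensity]
        ring
    _ = c * ω * ∫⁻ w, jetDensity k w * G (α • w.1, l • w.2) := by
        rw [lintegral_const_mul, mul_assoc]
        have := measurable_jetDensity k
        exact this.mul (hG.comp (by fun_prop))

/-! ### Radial integrals and integrals of the jet density -/

lemma lintegral_Ioi_pow_mul_ofReal_sub_sq_pow (j : ℕ) {m : ℕ} (hm : m ≠ 0) (c : ℝ) :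
    ∫⁻ r in Ioi (0 : ℝ), ENNReal.ofReal (r ^ j) * ENNReal.ofReal (c - r ^ 2) ^ m =
      ENNReal.ofReal (∫ r in (0 : ℝ)..√c, r ^ j * (c - r ^ 2) ^ m) := by
  have hle : ∀ r ∈ Ioc 0 √c, 0 ≤ c - r ^ 2 := fun r hr => by
    have hc : 0 ≤ c := by
      by_contra h
      have := Real.sqrt_eq_zero_of_nonpos (not_le.1 h).le
      linarith [hr.1, hr.2]
    have := pow_le_pow_left₀ hr.1.le hr.2 2
    rw [Real.sq_sqrt hc] at this
    linarith
  rw [intervalIntegral.integral_of_le (Real.sqrt_nonneg c),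
    ofReal_integral_eq_lintegral_ofReal]
  · have hsub : Ioc 0 √c ⊆ Ioi 0 := fun r hr => hr.1
    rw [← lintegral_inter_add_sdiff _ (Ioi 0) (measurableSet_Ioc (a := 0) (b := √c)),
      inter_eq_right.2 hsub]
    rw [setLIntegral_congr_fun (s := Ioi 0 \ Ioc 0 √c) (g := fun _ => 0)
      (measurableSet_Ioi.diff measurableSet_Ioc), lintegral_zero, add_zero]
    · refine setLIntegral_congr_fun measurableSet_Ioc fun r hr => ?_
      rw [ENNReal.ofReal_mul (pow_nonneg hr.1.le _), ENNReal.ofReal_pow (hle r hr)]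
    · intro r hr
      have h0 : (0 : ℝ) < r := hr.1
      have h1 : √c < r := by
        by_contra h
        exact hr.2 ⟨h0, not_lt.1 h⟩
      have : c ≤ r ^ 2 := ((Real.sqrt_lt' h0).1 h1).le
      simp only
      rw [ENNReal.ofReal_of_nonpos (p := c - r ^ 2) (by linarith), zero_pow hm, mul_zero]
  · exact (Continuous.integrableOn_Icc (by fun_prop)).mono_set Ioc_subset_Icc_self
  · filter_upwards [ae_restrict_mem measurableSet_Ioc] with r hr
    exact mul_nonneg (pow_nonneg hr.1.le _) (pow_nonneg (hle r hr) _)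

lemma integral_mul_sub_sq_pow (k : ℕ) {c : ℝ} (hc : 0 ≤ c) :
    ∫ r in (0 : ℝ)..√c, r ^ 1 * (c - r ^ 2) ^ k = c ^ (k + 1) / (2 * (k + 1)) := by
  have hk : (2 * (k + 1) : ℝ) ≠ 0 := by positivity
  have hd : ∀ r : ℝ, HasDerivAt (fun r : ℝ => -(c - r ^ 2) ^ (k + 1) / (2 * (k + 1)))
      (r ^ 1 * (c - r ^ 2) ^ k) r := fun r => by
    have := ((((hasDerivAt_pow 2 r).const_sub c).pow (k + 1)).neg).div_const (2 * (k + 1) : ℝ)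
    refine this.congr_deriv ?_
    push_cast
    field_simp
  rw [intervalIntegral.integral_eq_sub_of_hasDerivAt (fun r _ => hd r)
    (Continuous.intervalIntegrable (by fun_prop) _ _), Real.sq_sqrt hc]
  simp
  ring

lemma integral_sq_mul_sub_sq_pow (m : ℕ) (a : ℝ) :
    ∫ r in (0 : ℝ)..a, r ^ 2 * (a ^ 2 - r ^ 2) ^ m =
      (2 ^ (2 * m + 1) * m.factorial * (m + 1).factorial / (2 * m + 3).factorial : ℝ) *
        a ^ (2 * m + 3) := by
  induction m with
  | zero =>
    simp [integral_pow, Nat.factorial]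
    ring
  | succ m ih =>
    -- This primitive vanishes at `0` and `a`, which yields the recursion `(2m + 5) I(m+1) = 2 (m +
    -- 1) a² I(m)`.
    have hd : ∀ r : ℝ, HasDerivAt (fun r : ℝ => r ^ 3 * (a ^ 2 - r ^ 2) ^ (m + 1))
        ((2 * m + 5) * (r ^ 2 * (a ^ 2 - r ^ 2) ^ (m + 1)) -
          (2 * (m + 1) * a ^ 2) * (r ^ 2 * (a ^ 2 - r ^ 2) ^ m)) r := fun r => by
      have := (hasDerivAt_pow 3 r).mul (((hasDerivAt_pow 2 r).const_sub (a ^ 2)).pow (m + 1))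
      refine this.congr_deriv ?_
      push_cast
      simp only [Pi.pow_apply]
      ring
    have h := intervalIntegral.integral_eq_sub_of_hasDerivAt (a := 0) (b := a) (fun r _ => hd r)
      (Continuous.intervalIntegrable (by fun_prop) _ _)
    rw [intervalIntegral.integral_sub (Continuous.intervalIntegrable (by fun_prop) _ _)
      (Continuous.intervalIntegrable (by fun_prop) _ _), intervalIntegral.integral_const_mul,
      intervalIntegral.integral_const_mul, ih] at h
    simp only [sub_self, ne_eq, Nat.add_eq_zero_iff, one_ne_zero, and_false, not_false_eq_true,
      zero_pow, mul_zero, OfNat.ofNat_ne_zero, zero_mul] at h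
    have hf : ((2 * (m + 1) + 3).factorial : ℝ) =
        (2 * m + 5) * ((2 * m + 4) * (2 * m + 3).factorial) := by
      have e : 2 * (m + 1) + 3 = (2 * m + 4) + 1 := by ring
      rw [e, Nat.factorial_succ, Nat.factorial_succ (2 * m + 3)]
      push_cast; ring
    have hpos : ((2 * m + 3).factorial : ℝ) ≠ 0 := by positivity
    have h5 : (2 * m + 5 : ℝ) ≠ 0 := by positivity
    have h4 : (2 * m + 4 : ℝ) ≠ 0 := by positivity
    refine mul_left_cancel₀ h5 ?_
    rw [sub_eq_zero.1 h, hf, Nat.factorial_succ (m + 1), Nat.factorial_succ m]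
    push_cast
    field_simp
    ring

/-- The value of `∫₀¹ r² (1 - r²)^m dr`. -/
def halfBeta (m : ℕ) : ℝ :=
  2 ^ (2 * m + 1) * m.factorial * (m + 1).factorial / (2 * m + 3).factorial

lemma halfBeta_nonneg (m : ℕ) : 0 ≤ halfBeta m := by unfold halfBeta; positivity

lemma integral_abs_sin_sub (η : ℝ) :
    ∫ θ in (-Real.pi)..Real.pi, |Real.sin (η - θ)| = 4 := by
  have hper : Function.Periodic (fun x : ℝ => |Real.sin x|) (2 * Real.pi) := fun x => by
    simp [Real.sin_add_two_pi]
  rw [intervalIntegral.integral_comp_sub_left (fun x => |Real.sin x|)]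
  have h1 := hper.intervalIntegral_add_eq (η - Real.pi) (-Real.pi)
  have e1 : η - Real.pi + 2 * Real.pi = η - -Real.pi := by ring
  have e2 : -Real.pi + 2 * Real.pi = Real.pi := by ring
  rw [e1, e2] at h1
  have hi : ∀ a b : ℝ, IntervalIntegrable (fun x => |Real.sin x|) volume a b := fun a b =>
    Continuous.intervalIntegrable (by fun_prop) _ _
  rw [h1, ← intervalIntegral.integral_add_adjacent_intervals (hi (-Real.pi) 0) (hi 0 Real.pi)]
  have hneg : ∫ x in (-Real.pi)..0, |Real.sin x| = ∫ x in (0 : ℝ)..Real.pi, |Real.sin x| := by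
    have := intervalIntegral.integral_comp_neg (a := 0) (b := Real.pi) (fun x => |Real.sin x|)
    simp only [Real.sin_neg, abs_neg, neg_zero] at this
    exact this.symm
  have hpos : ∫ x in (0 : ℝ)..Real.pi, |Real.sin x| = 2 := by
    have : ∫ x in (0 : ℝ)..Real.pi, Real.sin x = 2 := by
      rw [integral_sin, Real.cos_zero, Real.cos_pi]; norm_num
    rw [← this]
    refine intervalIntegral.integral_congr fun x hx => ?_
    rw [uIcc_of_le Real.pi_pos.le] at hx
    exact abs_of_nonneg (Real.sin_nonneg_of_mem_Icc hx)
  rw [hneg, hpos]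
  norm_num

/-- The determinant of two plane vectors. -/
def cross (v w : ℝ × ℝ) : ℝ := v.1 * w.2 - v.2 * w.1

lemma continuous_cross : Continuous fun z : (ℝ × ℝ) × (ℝ × ℝ) => cross z.1 z.2 := by
  unfold cross; fun_prop

/-- Integrals of products of a radial and an angular function over the plane. -/
lemma lintegral_polar {F : ℝ × ℝ → ENNReal} {g h : ℝ → ENNReal} (hg : Measurable g)
    (hh : Measurable h)
    (hF : ∀ r > 0, ∀ θ, ENNReal.ofReal r * F (r * Real.cos θ, r * Real.sin θ) = g r * h θ) :
    ∫⁻ v, F v = (∫⁻ r in Ioi (0 : ℝ), g r) * ∫⁻ θ in Ioo (-Real.pi) Real.pi, h θ := by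
  rw [← lintegral_comp_polarCoord_symm,
    setLIntegral_congr_fun (g := fun p => g p.1 * h p.2)
      (polarCoord.open_target.measurableSet) fun p hp => by
        simpa [polarCoord] using hF p.1 hp.1 p.2]
  have ht : polarCoord.target = Ioi 0 ×ˢ Ioo (-Real.pi) Real.pi := rfl
  rw [ht, Measure.volume_eq_prod, ← Measure.prod_restrict,
    lintegral_prod_mul hg.aemeasurable hh.aemeasurable]

lemma lintegral_radial {g : ℝ → ENNReal} (hg : Measurable g) :
    ∫⁻ v : ℝ × ℝ, g (v.1 ^ 2 + v.2 ^ 2) =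
      ENNReal.ofReal (2 * Real.pi) * ∫⁻ r in Ioi (0 : ℝ), ENNReal.ofReal (r ^ 1) * g (r ^ 2) := by
  rw [lintegral_polar (g := fun r => ENNReal.ofReal (r ^ 1) * g (r ^ 2)) (h := fun _ => 1)
    (by fun_prop) (by fun_prop), mul_comm]
  · simp [two_mul]
  · intro r hr θ
    have : (r * Real.cos θ) ^ 2 + (r * Real.sin θ) ^ 2 = r ^ 2 := by
      linear_combination r ^ 2 * Real.cos_sq_add_sin_sq θ
    simp [this]

/-- In polar coordinates the cross product is `r |w| sin` of the angle between the vectors. The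
angular integral of `|sin|` is `4` for every direction of `w`. -/
lemma lintegral_radial_mul_abs_cross {g : ℝ → ENNReal} (hg : Measurable g) (w : ℝ × ℝ) :
    ∫⁻ v : ℝ × ℝ, g (v.1 ^ 2 + v.2 ^ 2) * ENNReal.ofReal |cross v w| =
      ENNReal.ofReal (4 * √(w.1 ^ 2 + w.2 ^ 2)) *
        ∫⁻ r in Ioi (0 : ℝ), ENNReal.ofReal (r ^ 2) * g (r ^ 2) := by
  set z : ℂ := ⟨w.1, w.2⟩
  set s := √(w.1 ^ 2 + w.2 ^ 2) with hs
  have hz : ‖z‖ = s := by rw [Complex.norm_eq_sqrt_sq_add_sq]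
  have hs0 : 0 ≤ s := Real.sqrt_nonneg _
  have hw1 : w.1 = s * Real.cos z.arg := by rw [← hz, Complex.norm_mul_cos_arg]
  have hw2 : w.2 = s * Real.sin z.arg := by rw [← hz, Complex.norm_mul_sin_arg]
  rw [lintegral_polar (g := fun r => ENNReal.ofReal (r ^ 2) * g (r ^ 2))
    (h := fun θ => ENNReal.ofReal (s * |Real.sin (z.arg - θ)|))
    (by fun_prop) (by fun_prop), mul_comm]
  · congr 1
    rw [restrict_Ioo_eq_restrict_Ioc, ← ofReal_integral_eq_lintegral_ofReal,
      ← intervalIntegral.integral_of_le (by linarith [Real.pi_pos]),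
      intervalIntegral.integral_const_mul, integral_abs_sin_sub, mul_comm]
    · exact (Continuous.integrableOn_Icc (by fun_prop)).mono_set Ioc_subset_Icc_self
    · exact Filter.Eventually.of_forall fun θ => mul_nonneg hs0 (abs_nonneg _)
  · intro r hr θ
    have h1 : (r * Real.cos θ) ^ 2 + (r * Real.sin θ) ^ 2 = r ^ 2 := by
      linear_combination r ^ 2 * Real.cos_sq_add_sin_sq θ
    have h2 : cross (r * Real.cos θ, r * Real.sin θ) w = r * (s * Real.sin (z.arg - θ)) := by
      rw [cross, hw1, hw2, Real.sin_sub]; ring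
    simp only [h1, h2]
    rw [abs_mul, abs_of_pos hr, abs_mul, abs_of_nonneg hs0, ENNReal.ofReal_mul hr.le, sq r,
      ENNReal.ofReal_mul hr.le]
    ring

lemma lintegral_plane_ofReal_sub_pow (k : ℕ) (hk : k ≠ 0) (c : ℝ) :
    ∫⁻ v : ℝ × ℝ, ENNReal.ofReal (c - (v.1 ^ 2 + v.2 ^ 2)) ^ k =
      ENNReal.ofReal (Real.pi / (k + 1)) * ENNReal.ofReal c ^ (k + 1) := by
  rw [lintegral_radial (g := fun s => ENNReal.ofReal (c - s) ^ k) (by fun_prop),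
    lintegral_Ioi_pow_mul_ofReal_sub_sq_pow 1 hk]
  rcases le_total 0 c with hc | hc
  · rw [integral_mul_sub_sq_pow k hc, ← ENNReal.ofReal_mul (by positivity),
      ← ENNReal.ofReal_pow hc, ← ENNReal.ofReal_mul (by positivity)]
    congr 1
    field_simp
  · simp [Real.sqrt_eq_zero_of_nonpos hc, ENNReal.ofReal_of_nonpos hc]

/-- The total mass of the jet density. -/
lemma lintegral_jetDensity (m : ℕ) (hm : m ≠ 0) :
    ∫⁻ w, jetDensity m w = ENNReal.ofReal (Real.pi ^ 2 / ((m + 1) * (m + 2))) := by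
  rw [Measure.volume_eq_prod, lintegral_prod _ (measurable_jetDensity m).aemeasurable]
  have h (u : ℝ × ℝ) : ∫⁻ v : ℝ × ℝ, jetDensity m (u, v) =
      ENNReal.ofReal (Real.pi / (m + 1)) *
        ENNReal.ofReal (1 - (u.1 ^ 2 + u.2 ^ 2)) ^ (m + 1) := by
    rw [← lintegral_plane_ofReal_sub_pow m hm]
    simp only [jetDensity, pairNormSq, sub_sub]
  simp only [h]
  rw [lintegral_const_mul _ (by fun_prop), lintegral_plane_ofReal_sub_pow _ (by omega),
    ENNReal.ofReal_one, one_pow, mul_one, ← ENNReal.ofReal_mul (by positivity)]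
  congr 1
  push_cast
  field_simp
  ring

/-- Here `z.1` is the common position of two curves, and `z.2`, `w` are their velocities. With `c =
1 - |z.1|²`, integrating out the two velocities gives the factors `4 β c^(m + 3/2)` and `2 π β c^(m
+ 3/2)`, where `β = halfBeta m`; the position integral of `c^(2m + 3)` is `π / (2m + 4)`. -/
lemma lintegral_jetDensity_mul_cross (m : ℕ) (hm : m ≠ 0) :
    ∫⁻ w : ℝ × ℝ, ∫⁻ z : (ℝ × ℝ) × (ℝ × ℝ),
      jetDensity m z * (jetDensity m (z.1, w) * ENNReal.ofReal |cross z.2 w|) =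
      ENNReal.ofReal (8 * Real.pi ^ 2 * halfBeta m ^ 2 / (2 * m + 4)) := by
  have hR (c : ℝ) : ∫⁻ r in Ioi (0 : ℝ), ENNReal.ofReal (r ^ 2) * ENNReal.ofReal (c - r ^ 2) ^ m =
      ENNReal.ofReal (halfBeta m * √c ^ (2 * m + 3)) := by
    rw [lintegral_Ioi_pow_mul_ofReal_sub_sq_pow 2 hm]
    congr 1
    rcases le_total 0 c with hc | hc
    · rw [halfBeta, ← integral_sq_mul_sub_sq_pow, Real.sq_sqrt hc]
    · simp [Real.sqrt_eq_zero_of_nonpos hc]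
  have hin (u w : ℝ × ℝ) : ∫⁻ v : ℝ × ℝ,
      jetDensity m (u, v) * (jetDensity m (u, w) * ENNReal.ofReal |cross v w|) =
      ENNReal.ofReal (1 - (u.1 ^ 2 + u.2 ^ 2) - (w.1 ^ 2 + w.2 ^ 2)) ^ m *
        ENNReal.ofReal √(w.1 ^ 2 + w.2 ^ 2) *
      (4 * ENNReal.ofReal (halfBeta m * √(1 - (u.1 ^ 2 + u.2 ^ 2)) ^ (2 * m + 3))) := by
    have h := lintegral_radial_mul_abs_cross
      (g := fun s => ENNReal.ofReal (1 - (u.1 ^ 2 + u.2 ^ 2) - s) ^ m) (by fun_prop) w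
    have hc : Measurable fun v : ℝ × ℝ => cross v w := by unfold cross; fun_prop
    calc _ = ∫⁻ v : ℝ × ℝ, ENNReal.ofReal (1 - (u.1 ^ 2 + u.2 ^ 2) - (w.1 ^ 2 + w.2 ^ 2)) ^ m *
          (ENNReal.ofReal (1 - (u.1 ^ 2 + u.2 ^ 2) - (v.1 ^ 2 + v.2 ^ 2)) ^ m *
            ENNReal.ofReal |cross v w|) := lintegral_congr fun v => by
          simp only [jetDensity, pairNormSq, sub_sub]; ring
      _ = _ := by
          rw [lintegral_const_mul _ (by fun_prop), h, ENNReal.ofReal_mul (by norm_num), ← hR]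
          simp only [ENNReal.ofReal_ofNat]
          ring
  have hsplit (w : ℝ × ℝ) : ∫⁻ z : (ℝ × ℝ) × (ℝ × ℝ),
      jetDensity m z * (jetDensity m (z.1, w) * ENNReal.ofReal |cross z.2 w|) =
      ∫⁻ u : ℝ × ℝ, ∫⁻ v : ℝ × ℝ,
      jetDensity m (u, v) * (jetDensity m (u, w) * ENNReal.ofReal |cross v w|) := by
    have h1 : Measurable fun z : (ℝ × ℝ) × (ℝ × ℝ) =>
        jetDensity m z * (jetDensity m (z.1, w) * ENNReal.ofReal |cross z.2 w|) := by
      unfold jetDensity pairNormSq cross; fun_prop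
    rw [Measure.volume_eq_prod, lintegral_prod _ h1.aemeasurable]
  simp only [hsplit, hin]
  rw [lintegral_lintegral_swap (by fun_prop)]
  have hout (u : ℝ × ℝ) : ∫⁻ w : ℝ × ℝ,
      ENNReal.ofReal (1 - (u.1 ^ 2 + u.2 ^ 2) - (w.1 ^ 2 + w.2 ^ 2)) ^ m *
        ENNReal.ofReal √(w.1 ^ 2 + w.2 ^ 2) *
      (4 * ENNReal.ofReal (halfBeta m * √(1 - (u.1 ^ 2 + u.2 ^ 2)) ^ (2 * m + 3))) =
      ENNReal.ofReal (8 * Real.pi * halfBeta m ^ 2) *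
        ENNReal.ofReal (1 - (u.1 ^ 2 + u.2 ^ 2)) ^ (2 * m + 3) := by
    set c := 1 - (u.1 ^ 2 + u.2 ^ 2)
    have hrad : ∫⁻ w : ℝ × ℝ, ENNReal.ofReal (c - (w.1 ^ 2 + w.2 ^ 2)) ^ m *
        ENNReal.ofReal √(w.1 ^ 2 + w.2 ^ 2) = ENNReal.ofReal (2 * Real.pi) *
          ENNReal.ofReal (halfBeta m * √c ^ (2 * m + 3)) := by
      rw [lintegral_radial (g := fun s => ENNReal.ofReal (c - s) ^ m * ENNReal.ofReal √s)
        (by fun_prop), ← hR]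
      congr 1
      refine setLIntegral_congr_fun measurableSet_Ioi fun r (hr : 0 < r) => ?_
      rw [Real.sqrt_sq hr.le, pow_one, sq r, ENNReal.ofReal_mul hr.le]
      ring
    have hβ := halfBeta_nonneg m
    rw [lintegral_mul_const _ (by fun_prop), hrad]
    rcases le_total 0 c with hc | hc
    · rw [← ENNReal.ofReal_ofNat 4, ← ENNReal.ofReal_pow hc, ← ENNReal.ofReal_mul (by positivity),
        ← ENNReal.ofReal_mul (by positivity), ← ENNReal.ofReal_mul (by positivity),
        ← ENNReal.ofReal_mul (by positivity)]
      congr 1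
      have : c ^ (2 * m + 3) = √c ^ (2 * m + 3) * √c ^ (2 * m + 3) := by
        rw [← mul_pow, Real.mul_self_sqrt hc]
      rw [this]; ring
    · simp [Real.sqrt_eq_zero_of_nonpos hc, ENNReal.ofReal_of_nonpos hc]
  simp only [hout]
  rw [lintegral_const_mul _ (by fun_prop), lintegral_plane_ofReal_sub_pow _ (by omega),
    ENNReal.ofReal_one, one_pow, mul_one, ← ENNReal.ofReal_mul (by positivity)]
  congr 1
  push_cast
  field_simp
  ring

/-! ### Measurability of the number of intersections -/

lemma TrigCurve.continuous_eval_prod {N : ℕ} :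
    Continuous fun z : TrigCurve N × ℝ => TrigCurve.eval z.1 z.2 := by
  have h := FourierPoly.continuous_eval_prod (N := N)
  exact (h.comp (by fun_prop : Continuous fun z : TrigCurve N × ℝ => (z.1.1, z.2))).prodMk
    (h.comp (by fun_prop : Continuous fun z : TrigCurve N × ℝ => (z.1.2, z.2)))

lemma isClosed_exists_mem_isCompact {Ω X : Type*} [TopologicalSpace Ω] [TopologicalSpace X]
    {K : Set X} (hK : IsCompact K) {P : Set (Ω × X)} (hP : IsClosed P) :
    IsClosed {p | ∃ t ∈ K, (p, t) ∈ P} := by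
  have := isCompact_iff_compactSpace.1 hK
  have h1 : IsClosed ((fun z : Ω × K => (z.1, (z.2 : X))) ⁻¹' P) := hP.preimage (by fun_prop)
  convert isClosedMap_fst_of_compactSpace _ h1 using 1
  ext p
  simp

lemma measurableSet_intersectionParams_hits {N : ℕ} {U : Set (ℝ × ℝ)} (hU : IsOpen U) :
    MeasurableSet {p : TrigCurve N × TrigCurve N | (intersectionParams p ∩ U).Nonempty} := by
  -- The half-open square is not compact. Its open upper edges are absorbed into the open set, which
  -- is exhausted by countably many closed sets; cutting these with the closed quadrant leaves
  -- compact pieces, each with a closed hitting set.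
  let T : Set (ℝ × ℝ) := Iio (2 * Real.pi) ×ˢ Iio (2 * Real.pi)
  have hT : IsOpen (T ∩ U) := (isOpen_Iio.prod isOpen_Iio).inter hU
  obtain ⟨F, hFc, -, hFU, -⟩ := hT.exists_iUnion_isClosed
  let K : ℕ → Set (ℝ × ℝ) := fun n => (Ici 0 ×ˢ Ici 0) ∩ F n
  have hK : ∀ n, IsCompact (K n) := fun n => by
    refine ((isCompact_Icc (a := (0 : ℝ)) (b := 2 * Real.pi)).prod
      (isCompact_Icc (a := (0 : ℝ)) (b := 2 * Real.pi))).of_isClosed_subset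
      ((isClosed_Ici.prod isClosed_Ici).inter (hFc n)) ?_
    rintro t ⟨⟨h1, h2⟩, h3⟩
    have h4 : t ∈ T ∩ U := hFU ▸ mem_iUnion_of_mem n h3
    exact ⟨⟨h1, le_of_lt h4.1.1⟩, ⟨h2, le_of_lt h4.1.2⟩⟩
  let P : Set ((TrigCurve N × TrigCurve N) × (ℝ × ℝ)) :=
    {z | TrigCurve.eval z.1.1 z.2.1 = TrigCurve.eval z.1.2 z.2.2}
  have hP : IsClosed P := by
    have h := TrigCurve.continuous_eval_prod (N := N)
    exact isClosed_eq
      (h.comp (by fun_prop : Continuous fun z : (TrigCurve N × TrigCurve N) × (ℝ × ℝ) =>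
        (z.1.1, z.2.1)))
      (h.comp (by fun_prop : Continuous fun z : (TrigCurve N × TrigCurve N) × (ℝ × ℝ) =>
        (z.1.2, z.2.2)))
  have : {p : TrigCurve N × TrigCurve N | (intersectionParams p ∩ U).Nonempty} =
      ⋃ n, {p | ∃ t ∈ K n, (p, t) ∈ P} := by
    ext p
    simp only [mem_iUnion, mem_ofPred_eq]
    constructor
    · rintro ⟨t, ⟨h1, h2, h3⟩, h4⟩
      have : t ∈ ⋃ n, F n := hFU ▸ ⟨⟨h1.2, h2.2⟩, h4⟩
      obtain ⟨n, hn⟩ := mem_iUnion.1 this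
      exact ⟨n, t, ⟨⟨h1.1, h2.1⟩, hn⟩, h3⟩
    · rintro ⟨n, t, ⟨⟨h1, h2⟩, h3⟩, h4⟩
      have h5 : t ∈ T ∩ U := hFU ▸ mem_iUnion_of_mem n h3
      exact ⟨t, ⟨⟨h1, h5.1.1⟩, ⟨h2, h5.1.2⟩, h4⟩, h5.2⟩
  rw [this]
  exact MeasurableSet.iUnion fun n => (isClosed_exists_mem_isCompact (hK n) hP).measurableSet

lemma measurableSet_intersectionParams_encard_eq (N : ℕ) (k : ℕ) :
    MeasurableSet {p : TrigCurve N × TrigCurve N | (intersectionParams p).encard = k} := by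
  have h := measurable_encard_of_hits (Z := intersectionParams (N := N))
    fun U hU => measurableSet_intersectionParams_hits hU
  have : {p : TrigCurve N × TrigCurve N | (intersectionParams p).encard = k} =
      {p | (k : ℕ∞) ≤ (intersectionParams p).encard} \
        {p | ((k + 1 : ℕ) : ℕ∞) ≤ (intersectionParams p).encard} := by
    ext p
    simp only [mem_ofPred_eq, mem_sdiff, not_le]
    push_cast
    rw [ENat.lt_natCast_add_one_iff, le_antisymm_iff, and_comm]
  rw [this]
  exact (h k).diff (h (k + 1))

lemma measurable_encard_intersectionParams (N : ℕ) :
    Measurable fun p : TrigCurve N × TrigCurve N => ((intersectionParams p).encard : ENNReal) := by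
  have : Measurable fun p : TrigCurve N × TrigCurve N => (intersectionParams p).encard := by
    refine ENat.measurable_iff.2 fun k => ?_
    exact measurableSet_intersectionParams_encard_eq N k
  exact (measurable_of_countable fun n : ℕ∞ => (n : ENNReal)).comp this

/-! ### Double points of one curve on the other -/

namespace FourierPoly

variable {N : ℕ}

/-- The constant function `1`. -/
def one (N : ℕ) : FourierPoly N := (Pi.single 0 1, 0)

lemma eval_one (φ : ℝ) : eval (one N) φ = 1 := by
  rw [eval_eq]
  simp [one, harmonic]

lemma eval_add (p q : FourierPoly N) (φ : ℝ) : eval (p + q) φ = eval p φ + eval q φ := by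
  simp [eval, add_mul, Finset.sum_add_distrib]
  ring

lemma eval_smul (c : ℝ) (p : FourierPoly N) (φ : ℝ) : eval (c • p) φ = c * eval p φ := by
  simp [eval, mul_assoc, Finset.mul_sum, mul_add]

lemma differentiable_eval_prod :
    Differentiable ℝ fun z : FourierPoly N × ℝ => eval z.1 z.2 := by
  unfold eval; fun_prop

/-- The Fourier polynomial without its constant term and its component along `e`. -/
def reduced (e : FourierPoly N) (c : FourierPoly N →L[ℝ] ℝ) (q : FourierPoly N) : FourierPoly N :=
  q - q.1 0 • one N - c q • e

/-- Adjusts the constant term and the component along `e` so that the value at `z.2.2.1` is `z.2.1`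
and agrees with the value at `z.2.2.2`. -/
def adjusted (e : FourierPoly N) (c : FourierPoly N →L[ℝ] ℝ)
    (z : FourierPoly N × ℝ × ℝ × ℝ) : FourierPoly N :=
  let b := -(eval (reduced e c z.1) z.2.2.1 - eval (reduced e c z.1) z.2.2.2) /
    (eval e z.2.2.1 - eval e z.2.2.2)
  reduced e c z.1 + b • e +
    (z.2.1 - eval (reduced e c z.1) z.2.2.1 - b * eval e z.2.2.1) • one N

lemma differentiableAt_adjusted (e : FourierPoly N) (c : FourierPoly N →L[ℝ] ℝ)
    {z : FourierPoly N × ℝ × ℝ × ℝ} (hz : eval e z.2.2.1 ≠ eval e z.2.2.2) :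
    DifferentiableAt ℝ (adjusted e c) z := by
  have h := differentiable_eval_prod (N := N)
  have hr : Differentiable ℝ (reduced e c) := by unfold reduced; fun_prop
  have h1 : Differentiable ℝ fun z : FourierPoly N × ℝ × ℝ × ℝ =>
      eval (reduced e c z.1) z.2.2.1 :=
    h.comp (by fun_prop : Differentiable ℝ fun z : FourierPoly N × ℝ × ℝ × ℝ =>
      (reduced e c z.1, z.2.2.1))
  have h2 : Differentiable ℝ fun z : FourierPoly N × ℝ × ℝ × ℝ =>
      eval (reduced e c z.1) z.2.2.2 :=
    h.comp (by fun_prop : Differentiable ℝ fun z : FourierPoly N × ℝ × ℝ × ℝ =>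
      (reduced e c z.1, z.2.2.2))
  have h3 : Differentiable ℝ fun z : FourierPoly N × ℝ × ℝ × ℝ => eval e z.2.2.1 :=
    h.comp (by fun_prop : Differentiable ℝ fun z : FourierPoly N × ℝ × ℝ × ℝ => (e, z.2.2.1))
  have h4 : Differentiable ℝ fun z : FourierPoly N × ℝ × ℝ × ℝ => eval e z.2.2.2 :=
    h.comp (by fun_prop : Differentiable ℝ fun z : FourierPoly N × ℝ × ℝ × ℝ => (e, z.2.2.2))
  have hb : DifferentiableAt ℝ (fun z : FourierPoly N × ℝ × ℝ × ℝ =>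
      -(eval (reduced e c z.1) z.2.2.1 - eval (reduced e c z.1) z.2.2.2) /
        (eval e z.2.2.1 - eval e z.2.2.2)) z := by
      have h5 := (h3 z).fun_sub (h4 z)
      simp only [div_eq_mul_inv]
      exact (((h1 z).fun_sub (h2 z)).fun_neg).fun_mul (h5.fun_inv (sub_ne_zero.2 hz))
  have hz1 : DifferentiableAt ℝ (fun z : FourierPoly N × ℝ × ℝ × ℝ => z.2.1) z := by fun_prop
  have hr1 : DifferentiableAt ℝ (fun z : FourierPoly N × ℝ × ℝ × ℝ => reduced e c z.1) z := by
    fun_prop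
  exact (hr1.add (hb.smul_const e)).add (((hz1.sub (h1 z)).sub (hb.mul (h3 z))).smul_const (one N))

/-- The constant term and the `e`-coordinate are invisible to `reduced`, so these two slots can
store real parameters. -/
lemma reduced_add_smul {e : FourierPoly N} {c : FourierPoly N →L[ℝ] ℝ} (hce : c e = 1)
    (hco : c (one N) = 0) (he : e.1 0 = 0) (q : FourierPoly N) (s t : ℝ) :
    reduced e c (reduced e c q + s • one N + t • e) = reduced e c q := by
  have h1 : (one N).1 0 = 1 := by simp [one]
  have h2 : (reduced e c q).1 0 = 0 := by simp [reduced, h1, he]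
  have h3 : c (reduced e c q) = 0 := by simp [reduced, hce, hco]
  have h4 : (reduced e c q + s • one N + t • e).1 0 = s := by simp [h1, h2, he]
  have h5 : c (reduced e c q + s • one N + t • e) = t := by simp [h3, hce, hco]
  unfold reduced at h4 h5 ⊢
  rw [h4, h5]
  abel

/-- The equality of the two values determines the `e`-coordinate, since `e` separates `φ` and `φ'`;
the common value then determines the constant term. -/
lemma adjusted_eq {e : FourierPoly N} {c : FourierPoly N →L[ℝ] ℝ} {q q' : FourierPoly N}
    (hq : reduced e c q' = reduced e c q) {φ φ' : ℝ}
    (hφ : eval e φ ≠ eval e φ') (h : eval q φ = eval q φ') :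
    adjusted e c (q', eval q φ, φ, φ') = q := by
  have hdec : q = reduced e c q + q.1 0 • one N + c q • e := by unfold reduced; abel
  have hev (θ : ℝ) : eval q θ = eval (reduced e c q) θ + q.1 0 + c q * eval e θ := by
    conv_lhs => rw [hdec]
    rw [eval_add, eval_add, eval_smul, eval_smul, eval_one, mul_one]
  have hb : -(eval (reduced e c q) φ - eval (reduced e c q) φ') / (eval e φ - eval e φ') = c q := by
    rw [div_eq_iff (sub_ne_zero.2 hφ)]
    linear_combination hev φ - hev φ' - h
  simp only [adjusted, hq, hb]
  conv_rhs => rw [hdec]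
  rw [hev φ]
  have : eval (reduced e c q) φ + q.1 0 + c q * eval e φ - eval (reduced e c q) φ -
    c q * eval e φ = q.1 0 := by ring
  rw [this]
  abel

end FourierPoly

lemma det_eq_zero_of_apply_eq_zero {E : Type*} [NormedAddCommGroup E] [NormedSpace ℝ E]
    [FiniteDimensional ℝ E] {L : E →L[ℝ] E} {v : E} (hv : v ≠ 0) (h : L v = 0) : L.det = 0 := by
  by_contra hdet
  apply hv
  exact (L.toContinuousLinearEquivOfDetNeZero hdet).map_eq_zero_iff.1
    ((L.toContinuousLinearEquivOfDetNeZero_apply hdet v).trans h)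

/-- A dimension count: the first curve loses four coordinates, recoverable from `g`, `φ`, `φ'`, `ψ`.
The three parameters fill only three of the four free slots, so a differentiable map between spaces
of equal dimension covers the set and is constant in one direction. Sard's theorem applies. -/
lemma volume_double_point_on_curve_aux {N : ℕ} {e : FourierPoly N} {c : FourierPoly N →L[ℝ] ℝ}
    (hce : c e = 1) (hco : c (one N) = 0) (he : e.1 0 = 0) :
    volume {p : TrigCurve N × TrigCurve N | ∃ φ φ' ψ, eval e φ ≠ eval e φ' ∧
      TrigCurve.eval p.1 φ = TrigCurve.eval p.1 φ' ∧
      TrigCurve.eval p.1 φ = TrigCurve.eval p.2 ψ} = 0 := by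
  -- `φ` and `φ'` are read from the constant term and `e`-coordinate of `x`, and `ψ` from the
  -- constant term of `y`.
  let G : TrigCurve N × TrigCurve N → TrigCurve N × TrigCurve N := fun p =>
    ((adjusted e c (p.1.1, eval p.2.1 (p.1.2.1 0), p.1.1.1 0, c p.1.1),
      adjusted e c (p.1.2, eval p.2.2 (p.1.2.1 0), p.1.1.1 0, c p.1.1)), p.2)
  let S : Set (TrigCurve N × TrigCurve N) := {p | eval e (p.1.1.1 0) ≠ eval e (c p.1.1)}
  have hdiff : ∀ p ∈ S, DifferentiableAt ℝ G p := by
    intro p hp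
    have h := differentiable_eval_prod (N := N)
    have h1 : Differentiable ℝ fun p : TrigCurve N × TrigCurve N => eval p.2.1 (p.1.2.1 0) :=
      h.comp (by fun_prop : Differentiable ℝ fun p : TrigCurve N × TrigCurve N =>
        (p.2.1, p.1.2.1 0))
    have h2 : Differentiable ℝ fun p : TrigCurve N × TrigCurve N => eval p.2.2 (p.1.2.1 0) :=
      h.comp (by fun_prop : Differentiable ℝ fun p : TrigCurve N × TrigCurve N =>
        (p.2.2, p.1.2.1 0))
    have h3 : DifferentiableAt ℝ (fun p : TrigCurve N × TrigCurve N =>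
        adjusted e c (p.1.1, eval p.2.1 (p.1.2.1 0), p.1.1.1 0, c p.1.1)) p :=
      DifferentiableAt.comp (g := adjusted e c) (f := fun p : TrigCurve N × TrigCurve N =>
          (p.1.1, eval p.2.1 (p.1.2.1 0), p.1.1.1 0, c p.1.1)) p
        (differentiableAt_adjusted e c hp) (by fun_prop)
    have h4 : DifferentiableAt ℝ (fun p : TrigCurve N × TrigCurve N =>
        adjusted e c (p.1.2, eval p.2.2 (p.1.2.1 0), p.1.1.1 0, c p.1.1)) p :=
      DifferentiableAt.comp (g := adjusted e c) (f := fun p : TrigCurve N × TrigCurve N =>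
          (p.1.2, eval p.2.2 (p.1.2.1 0), p.1.1.1 0, c p.1.1)) p
        (differentiableAt_adjusted e c hp) (by fun_prop)
    exact (h3.prodMk h4).prodMk (by fun_prop)
  -- The `e`-coordinate of `y` is the slot left empty.
  let v : TrigCurve N × TrigCurve N := ((0, e), 0)
  have hv : v ≠ 0 := fun h => by
    have : e = 0 := congrArg (fun p : TrigCurve N × TrigCurve N => p.1.2) h
    rw [this, map_zero] at hce
    exact zero_ne_one hce
  have hinv : ∀ p (s : ℝ), G (p + s • v) = G p := by
    intro p s
    have hr : reduced e c (p.1.2 + s • e) = reduced e c p.1.2 := by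
      simp [reduced, he, hce, add_smul]
      abel
    simp [G, v, adjusted, hr, he]
  have hdet : ∀ p ∈ S, (fderiv ℝ G p).det = 0 := by
    intro p hp
    refine det_eq_zero_of_apply_eq_zero hv ?_
    have h1 : HasDerivAt (fun s : ℝ => G (p + s • v)) (fderiv ℝ G p v) 0 :=
      (hdiff p hp).hasFDerivAt.hasLineDerivAt v
    simp only [hinv] at h1
    exact h1.unique (hasDerivAt_const 0 (G p))
  have hnull := addHaar_image_eq_zero_of_det_fderivWithin_eq_zero
    (volume : Measure (TrigCurve N × TrigCurve N)) (f := G) (s := S)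
    (fun p hp => (hdiff p hp).hasFDerivAt.hasFDerivWithinAt) hdet
  refine measure_mono_null ?_ hnull
  rintro ⟨⟨x, y⟩, g⟩ ⟨φ, φ', ψ, h1, h2, h3⟩
  have hone : (one N).1 0 = 1 := by simp [one]
  let x' := reduced e c x + φ • one N + φ' • e
  let y' := reduced e c y + ψ • one N + (0 : ℝ) • e
  have hr0 (q : FourierPoly N) : (reduced e c q).1 0 = 0 := by simp [reduced, hone, he]
  have hx0 : x'.1 0 = φ := by simp [x', hr0, hone, he]
  have hy0 : y'.1 0 = ψ := by simp [y', hr0, hone]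
  have hcx : c x' = φ' := by simp [x', reduced, hce, hco]
  refine ⟨((x', y'), g), ?_, ?_⟩
  · change eval e (x'.1 0) ≠ eval e (c x')
    rwa [hx0, hcx]
  · have hxx := reduced_add_smul hce hco he x φ φ'
    have hyy := reduced_add_smul hce hco he y ψ 0
    simp only [TrigCurve.eval, Prod.mk.injEq] at h2 h3
    have e1 := adjusted_eq (q' := x') hxx h1 h2.1
    have e2 := adjusted_eq (q' := y') hyy h1 h2.2
    rw [h3.1] at e1
    rw [h3.2] at e2
    simp only [G, hx0, hy0, hcx, e1, e2]

/-- Almost surely no double point of the first curve lies on the second curve. -/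
lemma volume_double_point_on_curve (M : ℕ) :
    volume {p : TrigCurve (M + 1) × TrigCurve (M + 1) | ∃ φ φ' ψ, φ ∈ Ico 0 (2 * Real.pi) ∧
      φ' ∈ Ico 0 (2 * Real.pi) ∧ φ ≠ φ' ∧ TrigCurve.eval p.1 φ = TrigCurve.eval p.1 φ' ∧
      TrigCurve.eval p.1 φ = TrigCurve.eval p.2 ψ} = 0 := by
  let c1 : FourierPoly (M + 1) →L[ℝ] ℝ :=
    (ContinuousLinearMap.proj (1 : Fin (M + 1 + 1))).comp (ContinuousLinearMap.fst ℝ _ _)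
  let c2 : FourierPoly (M + 1) →L[ℝ] ℝ :=
    (ContinuousLinearMap.proj (0 : Fin (M + 1))).comp (ContinuousLinearMap.snd ℝ _ _)
  -- Distinct points of the circle are separated by the cosine or by the sine, so two applications
  -- suffice.
  let e1 : FourierPoly (M + 1) := (Pi.single 1 1, 0)
  let e2 : FourierPoly (M + 1) := (0, Pi.single 0 1)
  have he1 (φ : ℝ) : eval e1 φ = Real.cos φ := by
    simp [eval, e1, Pi.single_apply]
  have he2 (φ : ℝ) : eval e2 φ = Real.sin φ := by
    simp [eval, e2, Pi.single_apply]
  have h1 := volume_double_point_on_curve_aux (e := e1) (c := c1) (by simp [c1, e1])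
    (by simp [c1, one]) (by simp [e1])
  have h2 := volume_double_point_on_curve_aux (e := e2) (c := c2) (by simp [c2, e2])
    (by simp [c2, one]) (by simp [e2])
  refine measure_mono_null ?_ (measure_union_null h1 h2)
  rintro p ⟨φ, φ', ψ, hφ, hφ', hne, h3, h4⟩
  by_cases hc : Real.cos φ = Real.cos φ'
  · by_cases hs : Real.sin φ = Real.sin φ'
    · exfalso
      have : Real.cos (φ - φ') = 1 := by
        rw [Real.cos_sub, hc, hs, ← sq, ← sq, Real.cos_sq_add_sin_sq]
      rw [Real.cos_eq_one_iff_of_lt_of_lt (by linarith [hφ.1, hφ'.2]) (by linarith [hφ.2, hφ'.1])]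
        at this
      exact hne (sub_eq_zero.1 this)
    · exact Or.inr ⟨φ, φ', ψ, by rwa [he2, he2], h3, h4⟩
  · exact Or.inl ⟨φ, φ', ψ, by rwa [he1, he1], h3, h4⟩

/-- Intersection points are the common values at the intersection parameters. -/
lemma image_intersectionParams {N : ℕ} (p : TrigCurve N × TrigCurve N) :
    (fun t : ℝ × ℝ => TrigCurve.eval p.1 t.1) '' intersectionParams p = intersectionPoints p := by
  have hper (f : TrigCurve N) : Function.Periodic (TrigCurve.eval f) (2 * Real.pi) := fun φ =>
    Prod.ext (periodic_eval f.1 φ) (periodic_eval f.2 φ)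
  ext x
  constructor
  · rintro ⟨t, ht, rfl⟩
    exact ⟨⟨t.1, rfl⟩, ⟨t.2, ht.2.2.symm⟩⟩
  · rintro ⟨⟨φ, rfl⟩, ⟨ψ, hψ⟩⟩
    obtain ⟨φ', hφ', h1⟩ := (hper p.1).exists_mem_Ico₀ Real.two_pi_pos φ
    obtain ⟨ψ', hψ', h2⟩ := (hper p.2).exists_mem_Ico₀ Real.two_pi_pos ψ
    exact ⟨(φ', ψ'), ⟨hφ', hψ', by rw [← h1, ← h2, hψ]⟩, h1.symm⟩

/-- Two parameter pairs over one point would differ in `φ` or in `ψ`, giving a double point of the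
first or of the second curve on the other; the second case follows by swapping the curves. -/
lemma ae_encard_intersectionPoints (M : ℕ) :
    ∀ᵐ p : TrigCurve (M + 1) × TrigCurve (M + 1),
      (intersectionPoints p).encard = (intersectionParams p).encard := by
  have h := volume_double_point_on_curve M
  have hsw : MeasurePreserving (Prod.swap : TrigCurve (M + 1) × TrigCurve (M + 1) → _)
      volume volume := Measure.measurePreserving_swap
  have h' := hsw.quasiMeasurePreserving.preimage_null h
  filter_upwards [measure_eq_zero_iff_ae_notMem.1 h, measure_eq_zero_iff_ae_notMem.1 h']
    with p h1 h2
  rw [← image_intersectionParams]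
  refine InjOn.encard_image fun t ht t' ht' htt => ?_
  refine Prod.ext ?_ ?_
  · by_contra hne
    exact h1 ⟨t.1, t'.1, t.2, ht.1, ht'.1, hne, htt, ht.2.2⟩
  · by_contra hne
    refine h2 ⟨t.2, t'.2, t.1, ht.2.1, ht'.2.1, hne, ?_, ht.2.2.symm⟩
    exact ht.2.2.symm.trans (Eq.trans htt ht'.2.2)

/-! ### Averaging over translations -/

/-- Averaging an integral over the translates in the direction of a subgroup `ι A`, with a weight
`w ∘ s` of total mass one on each orbit. -/
lemma lintegral_eq_lintegral_translates {G A : Type*} [AddCommGroup G] [MeasurableSpace G]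
    [MeasurableAdd₂ G] [AddCommGroup A] [MeasurableSpace A] [MeasurableAdd₂ A] [MeasurableNeg A]
    (μ : Measure G) [SFinite μ] [μ.IsAddLeftInvariant] (ν : Measure A) [SFinite ν]
    [ν.IsAddLeftInvariant] [ν.IsNegInvariant] {ι : A → G} (hι : Measurable ι) {s : G → A}
    (hs : Measurable s) (hsι : ∀ x a, s (x + ι a) = s x + a) {w : A → ENNReal} (hw : Measurable w)
    (hw1 : ∫⁻ a, w a ∂ν = 1) {H : G → ENNReal} (hH : Measurable H) :
    ∫⁻ x, H x ∂μ = ∫⁻ x, w (s x) * ∫⁻ a, H (x + ι a) ∂ν ∂μ := by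
  symm
  calc ∫⁻ x, w (s x) * ∫⁻ a, H (x + ι a) ∂ν ∂μ
      = ∫⁻ x, ∫⁻ a, w (s x) * H (x + ι a) ∂ν ∂μ := by
        refine lintegral_congr fun x => ?_
        rw [lintegral_const_mul]
        exact hH.comp (by fun_prop)
    _ = ∫⁻ a, ∫⁻ x, w (s x) * H (x + ι a) ∂μ ∂ν := by
        refine lintegral_lintegral_swap (Measurable.aemeasurable ?_)
        exact (hw.comp (hs.comp measurable_fst)).mul (hH.comp (by fun_prop))
    -- The substitution `x ↦ x - ι a` moves the translation from `H` to the weight, which then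
    -- integrates to one in `a`.
    _ = ∫⁻ a, ∫⁻ x, w (s x - a) * H x ∂μ ∂ν := by
        refine lintegral_congr fun a => ?_
        rw [← lintegral_add_right_eq_self (fun x => w (s x - a) * H x) (ι a)]
        simp only [hsι, add_sub_cancel_right]
    _ = ∫⁻ x, ∫⁻ a, w (s x - a) * H x ∂ν ∂μ := by
        refine lintegral_lintegral_swap (Measurable.aemeasurable ?_)
        refine Measurable.mul (hw.comp ?_) (by fun_prop)
        simp only [sub_eq_add_neg]
        fun_prop
    _ = ∫⁻ x, H x ∂μ := by
        refine lintegral_congr fun x => ?_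
        have hm : Measurable fun a => s x - a := by
          simp only [sub_eq_add_neg]
          fun_prop
        rw [lintegral_mul_const _ (by exact hw.comp hm), lintegral_sub_left_eq_self (fun a => w a) (s x), hw1,
          one_mul]

namespace TrigCurve

variable {N : ℕ}

/-- The constant curves. -/
def const (N : ℕ) (a : ℝ × ℝ) : TrigCurve N := (a.1 • one N, a.2 • one N)

lemma continuous_constCurve : Continuous (const N) := by unfold const; fun_prop

lemma eval_add_const (f : TrigCurve N) (a : ℝ × ℝ) (φ : ℝ) :
    eval (f + const N a) φ = eval f φ + a := by
  simp [eval, const, FourierPoly.eval_add, FourierPoly.eval_smul, FourierPoly.eval_one]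
  rfl

lemma velocity_add_const (f : TrigCurve N) (a : ℝ × ℝ) (φ : ℝ) :
    velocity (f + const N a) φ = velocity f φ := by
  have h (p : FourierPoly N) (c : ℝ) : derivCoeff (p + c • one N) = derivCoeff p := by
    simp [derivCoeff, one]
  simp [velocity, const, h]

/-- The constant term of a curve. -/
def constTerm (f : TrigCurve N) : ℝ × ℝ := (f.1.1 0, f.2.1 0)

lemma measurable_constTerm : Measurable (constTerm : TrigCurve N → ℝ × ℝ) := by
  unfold constTerm; fun_prop

lemma constTerm_add_const (f : TrigCurve N) (a : ℝ × ℝ) :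
    constTerm (f + const N a) = constTerm f + a := by
  simp [constTerm, const, one]
  rfl

lemma continuous_velocity_prod :
    Continuous fun z : TrigCurve N × ℝ => velocity z.1 z.2 := by
  have hd : Continuous (derivCoeff : FourierPoly N → FourierPoly N) := by
    unfold derivCoeff
    refine Continuous.prodMk (continuous_pi fun i => ?_) (by fun_prop)
    refine Fin.cases ?_ (fun j => ?_) i <;> simp <;> fun_prop
  have h := FourierPoly.continuous_eval_prod (N := N)
  exact (h.comp (by fun_prop : Continuous fun z : TrigCurve N × ℝ => (derivCoeff z.1.1, z.2))).prodMk
    (h.comp (by fun_prop : Continuous fun z : TrigCurve N × ℝ => (derivCoeff z.1.2, z.2)))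

end TrigCurve

/-! ### The difference map and the counting formula -/

lemma hasStrictDerivAt_eval {N : ℕ} (p : FourierPoly N) (φ : ℝ) :
    HasStrictDerivAt (eval p) (eval (derivCoeff p) φ) φ :=
  hasStrictDerivAt_of_hasDerivAt_of_continuousAt
    (Filter.Eventually.of_forall fun x => hasDerivAt_eval p x) (continuous_eval _).continuousAt

/-- The derivative of `t ↦ g(t.2) - f(t.1)`. -/
def differenceDeriv {N : ℕ} (f g : TrigCurve N) (t : ℝ × ℝ) : ℝ × ℝ →L[ℝ] ℝ × ℝ :=
  (Matrix.toLin (.finTwoProd ℝ) (.finTwoProd ℝ)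
    !![-(f.velocity t.1).1, (g.velocity t.2).1;
       -(f.velocity t.1).2, (g.velocity t.2).2]).toContinuousLinearMap

lemma abs_det_differenceDeriv {N : ℕ} (f g : TrigCurve N) (t : ℝ × ℝ) :
    |(differenceDeriv f g t).det| = |cross (f.velocity t.1) (g.velocity t.2)| := by
  rw [differenceDeriv]
  conv_lhs => simp only [LinearMap.det_toContinuousLinearMap, LinearMap.det_toLin,
    Matrix.det_fin_two_of]
  rw [← abs_neg, cross]
  congr 1
  ring

lemma differenceDeriv_eq {N : ℕ} (f g : TrigCurve N) (t : ℝ × ℝ) : differenceDeriv f g t =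
    ((-(f.velocity t.1).1) • ContinuousLinearMap.fst ℝ ℝ ℝ +
      (g.velocity t.2).1 • ContinuousLinearMap.snd ℝ ℝ ℝ).prod
    ((-(f.velocity t.1).2) • ContinuousLinearMap.fst ℝ ℝ ℝ +
      (g.velocity t.2).2 • ContinuousLinearMap.snd ℝ ℝ ℝ) :=
  Matrix.toLin_finTwoProd_toContinuousLinearMap _ _ _ _

lemma continuous_differenceDeriv {N : ℕ} (f g : TrigCurve N) :
    Continuous (differenceDeriv f g) := by
  have h := TrigCurve.continuous_velocity_prod (N := N)
  have h1 : Continuous fun t : ℝ × ℝ => f.velocity t.1 :=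
    h.comp (by fun_prop : Continuous fun t : ℝ × ℝ => (f, t.1))
  have h2 : Continuous fun t : ℝ × ℝ => g.velocity t.2 :=
    h.comp (by fun_prop : Continuous fun t : ℝ × ℝ => (g, t.2))
  refine continuous_clm_apply.2 fun v => ?_
  simp only [differenceDeriv_eq]
  simp only [ContinuousLinearMap.prod_apply]
  have h3 {a b : ℝ × ℝ → ℝ} (ha : Continuous a) (hb : Continuous b) :
      Continuous fun t => -(a t * v.1) + b t * v.2 := by fun_prop
  refine Continuous.prodMk ?_ ?_
  · simpa using h3 h1.fst h2.fst
  · simpa using h3 h1.snd h2.snd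

lemma hasStrictFDerivAt_difference {N : ℕ} (f g : TrigCurve N) (t : ℝ × ℝ) :
    HasStrictFDerivAt (fun t : ℝ × ℝ => TrigCurve.eval g t.2 - TrigCurve.eval f t.1)
      (differenceDeriv f g t) t := by
  have h (p q : FourierPoly N) : HasStrictFDerivAt (fun t : ℝ × ℝ => eval q t.2 - eval p t.1)
      ((-(eval (derivCoeff p) t.1)) • ContinuousLinearMap.fst ℝ ℝ ℝ +
        (eval (derivCoeff q) t.2) • ContinuousLinearMap.snd ℝ ℝ ℝ) t := by
    have h1 := (hasStrictDerivAt_eval q t.2).comp_hasStrictFDerivAt t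
      (hasStrictFDerivAt_snd (𝕜 := ℝ) (E := ℝ) (F := ℝ) (p := t))
    have h2 := (hasStrictDerivAt_eval p t.1).comp_hasStrictFDerivAt t
      (hasStrictFDerivAt_fst (𝕜 := ℝ) (E := ℝ) (F := ℝ) (p := t))
    refine (h1.sub h2).congr_fderiv ?_
    ext <;> simp
  rw [differenceDeriv_eq]
  exact (h f.1 g.1).prodMk (h f.2 g.2)

/-- The indicator of the unit square. -/
def unitSquare : ℝ × ℝ → ENNReal := (Icc 0 1 ×ˢ Icc 0 1).indicator 1

lemma measurable_unitSquare : Measurable unitSquare :=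
  measurable_one.indicator (measurableSet_Icc.prod measurableSet_Icc)

lemma lintegral_unitSquare : ∫⁻ a, unitSquare a = 1 := by
  rw [unitSquare, lintegral_indicator_one (measurableSet_Icc.prod measurableSet_Icc),
    Measure.volume_eq_prod, Measure.prod_prod]
  simp

instance isAddHaarMeasure_volume_plane : (volume : Measure (ℝ × ℝ)).IsAddHaarMeasure :=
  isAddHaarMeasure_volume_prod _ _

lemma measurableAdd₂_prod (E F : Type*) [Add E] [Add F] [MeasurableSpace E] [MeasurableSpace F]
    [MeasurableAdd₂ E] [MeasurableAdd₂ F] : MeasurableAdd₂ (E × F) :=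
  ⟨Measurable.prodMk (by fun_prop : Measurable fun z : (E × F) × (E × F) => z.1.1 + z.2.1)
    (by fun_prop : Measurable fun z : (E × F) × (E × F) => z.1.2 + z.2.2)⟩

instance measurableAdd₂_trigCurve (N : ℕ) : MeasurableAdd₂ (TrigCurve N) :=
  have := measurableAdd₂_prod (Fin (N + 1) → ℝ) (Fin N → ℝ)
  measurableAdd₂_prod _ _

instance measurableAdd₂_trigCurve_prod (N : ℕ) : MeasurableAdd₂ (TrigCurve N × TrigCurve N) :=
  measurableAdd₂_prod _ _

instance sFinite_volume_trigCurve (N : ℕ) : SFinite (volume : Measure (TrigCurve N)) :=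
  have : SFinite (volume : Measure (FourierPoly N)) :=
    inferInstanceAs (SFinite ((volume : Measure (Fin (N + 1) → ℝ)).prod volume))
  inferInstanceAs (SFinite ((volume : Measure (FourierPoly N)).prod volume))

instance sFinite_volume_trigCurve_prod (N : ℕ) :
    SFinite (volume : Measure (TrigCurve N × TrigCurve N)) :=
  inferInstanceAs (SFinite ((volume : Measure (TrigCurve N)).prod volume))

/-- The integrand of the counting formula. -/
def incidence (r N : ℕ) (t : ℝ × ℝ) (p : TrigCurve N × TrigCurve N) : ENNReal :=
  unitSquare p.1.constTerm * ((sobolevBall r N).indicator 1 p.2 *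
    ((sobolevBall r N).indicator 1
      (p.1 + TrigCurve.const N (TrigCurve.eval p.2 t.2 - TrigCurve.eval p.1 t.1)) *
      ENNReal.ofReal |cross (p.1.velocity t.1) (p.2.velocity t.2)|))

lemma measurable_incidence (r N : ℕ) :
    Measurable fun z : (TrigCurve N × TrigCurve N) × (ℝ × ℝ) => incidence r N z.2 z.1 := by
  have hB : Measurable ((sobolevBall r N).indicator (1 : TrigCurve N → ENNReal)) :=
    measurable_one.indicator (isClosed_sobolevBall r N).measurableSet
  have he := TrigCurve.continuous_eval_prod (N := N)
  have hv := TrigCurve.continuous_velocity_prod (N := N)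
  have hc := TrigCurve.continuous_constCurve (N := N)
  have e1 : Continuous fun z : (TrigCurve N × TrigCurve N) × (ℝ × ℝ) =>
      TrigCurve.eval z.1.1 z.2.1 := he.comp (by fun_prop :
    Continuous fun z : (TrigCurve N × TrigCurve N) × (ℝ × ℝ) => (z.1.1, z.2.1))
  have e2 : Continuous fun z : (TrigCurve N × TrigCurve N) × (ℝ × ℝ) =>
      TrigCurve.eval z.1.2 z.2.2 := he.comp (by fun_prop :
    Continuous fun z : (TrigCurve N × TrigCurve N) × (ℝ × ℝ) => (z.1.2, z.2.2))
  have v1 : Continuous fun z : (TrigCurve N × TrigCurve N) × (ℝ × ℝ) =>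
      TrigCurve.velocity z.1.1 z.2.1 := hv.comp (by fun_prop :
    Continuous fun z : (TrigCurve N × TrigCurve N) × (ℝ × ℝ) => (z.1.1, z.2.1))
  have v2 : Continuous fun z : (TrigCurve N × TrigCurve N) × (ℝ × ℝ) =>
      TrigCurve.velocity z.1.2 z.2.2 := hv.comp (by fun_prop :
    Continuous fun z : (TrigCurve N × TrigCurve N) × (ℝ × ℝ) => (z.1.2, z.2.2))
  have hcr : Continuous fun z : (TrigCurve N × TrigCurve N) × (ℝ × ℝ) =>
      cross (TrigCurve.velocity z.1.1 z.2.1) (TrigCurve.velocity z.1.2 z.2.2) :=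
    continuous_cross.comp (v1.prodMk v2)
  refine Measurable.mul (measurable_unitSquare.comp
    (TrigCurve.measurable_constTerm.comp (by fun_prop))) (Measurable.mul (hB.comp (by fun_prop))
    (Measurable.mul (hB.comp ?_) ?_))
  · exact Continuous.measurable (by fun_prop)
  · exact (continuous_abs.comp hcr).measurable.ennreal_ofReal

/-- The total number of intersections of the pairs of curves from the unit ball. -/
lemma lintegral_encard_intersectionParams (r N : ℕ) :
    ∫⁻ p in sobolevBallSq r N, ((intersectionParams p).encard : ENNReal) =
      ∫⁻ t in Ico 0 (2 * Real.pi) ×ˢ Ico 0 (2 * Real.pi), ∫⁻ p, incidence r N t p := by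
  set S : Set (ℝ × ℝ) := Ico 0 (2 * Real.pi) ×ˢ Ico 0 (2 * Real.pi)
  have hS : MeasurableSet S := measurableSet_Ico.prod measurableSet_Ico
  have hBm : MeasurableSet (sobolevBall r N) := (isClosed_sobolevBall r N).measurableSet
  have hB2m : MeasurableSet (sobolevBallSq r N) := hBm.prod hBm
  have hc := TrigCurve.continuous_constCurve (N := N)
  rw [← lintegral_indicator hB2m, lintegral_eq_lintegral_translates volume
    (volume : Measure (ℝ × ℝ)) (ι := fun a => (TrigCurve.const N a, (0 : TrigCurve N)))
    (by fun_prop) (s := fun p => p.1.constTerm) (TrigCurve.measurable_constTerm.comp measurable_fst)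
    (fun p a => TrigCurve.constTerm_add_const p.1 a) measurable_unitSquare lintegral_unitSquare
    ((measurable_encard_intersectionParams N).indicator hB2m),
    ← lintegral_lintegral_swap (measurable_incidence r N).aemeasurable]
  refine lintegral_congr fun p => ?_
  obtain ⟨f, g⟩ := p
  have hB : Measurable ((sobolevBall r N).indicator (1 : TrigCurve N → ENNReal)) :=
    measurable_one.indicator hBm
  -- Only the first curve is translated: intersections of `f + a` with `g` are the preimages of `a`
  -- under the difference map, ready for the area formula.
  have hind (a : ℝ × ℝ) : (sobolevBallSq r N).indicator
      (fun p => ((intersectionParams p).encard : ENNReal)) ((f, g) + (TrigCurve.const N a, 0)) =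
      (sobolevBall r N).indicator 1 g * (sobolevBall r N).indicator 1 (f + TrigCurve.const N a) *
        ((S ∩ (fun t : ℝ × ℝ => TrigCurve.eval g t.2 - TrigCurve.eval f t.1) ⁻¹' {a}).encard :
          ENNReal) := by
    have hset : intersectionParams (f + TrigCurve.const N a, g) =
        S ∩ (fun t : ℝ × ℝ => TrigCurve.eval g t.2 - TrigCurve.eval f t.1) ⁻¹' {a} := by
      ext t
      simp only [intersectionParams, TrigCurve.eval_add_const, mem_ofPred_eq, mem_inter_iff,
        mem_preimage, mem_singleton_iff, S, mem_prod, and_assoc]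
      rw [sub_eq_iff_eq_add', eq_comm (a := TrigCurve.eval g t.2)]
    have hadd : ((f, g) : TrigCurve N × TrigCurve N) + (TrigCurve.const N a, 0) =
        (f + TrigCurve.const N a, g) := by simp
    rw [hadd, ← hset]
    by_cases h1 : g ∈ sobolevBall r N <;> by_cases h2 : f + TrigCurve.const N a ∈ sobolevBall r N <;>
      simp [sobolevBallSq, h1, h2]
  simp only [hind]
  rw [lintegral_mul_encard_preimage volume (hasStrictFDerivAt_difference f g)
    (continuous_differenceDeriv f g) hS (h := fun a => (sobolevBall r N).indicator 1 g *
      (sobolevBall r N).indicator 1 (f + TrigCurve.const N a))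
    (measurable_const.mul (hB.comp (by fun_prop))), ← lintegral_const_mul']
  · refine lintegral_congr fun t => ?_
    rw [abs_det_differenceDeriv, incidence]
    ring
  · unfold unitSquare
    rw [indicator_apply]
    split_ifs <;> simp

/-! ### Evaluation of the incidence integral at fixed parameters -/

lemma lintegral_comp_smul_plane {a : ℝ} (ha : 0 < a) {G : ℝ × ℝ → ENNReal} (hG : Measurable G) :
    ∫⁻ u, G (a • u) = ENNReal.ofReal (a ^ 2)⁻¹ * ∫⁻ u, G u := by
  have h := Measure.map_addHaar_smul (volume : Measure (ℝ × ℝ)) ha.ne'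
  rw [← lintegral_map hG (measurable_const_smul a), h, lintegral_smul_measure, smul_eq_mul,
    abs_of_nonneg (by positivity)]
  simp

/-- The integral of `|f'(φ) × w|` over the curves of the unit ball with `f(φ) = u`. -/
def slice (r N : ℕ) (φ : ℝ) (u w : ℝ × ℝ) : ENNReal :=
  ∫⁻ f : TrigCurve N, unitSquare f.constTerm *
    ((sobolevBall r N).indicator 1 (f + TrigCurve.const N (u - TrigCurve.eval f φ)) *
      ENNReal.ofReal |cross (f.velocity φ) w|)

lemma continuous_eval_left {N : ℕ} (φ : ℝ) : Continuous fun f : TrigCurve N => f.eval φ :=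
  TrigCurve.continuous_eval_prod.comp
    (by fun_prop : Continuous fun f : TrigCurve N => (f, φ))

lemma continuous_velocity_left {N : ℕ} (φ : ℝ) : Continuous fun f : TrigCurve N => f.velocity φ :=
  TrigCurve.continuous_velocity_prod.comp
    (by fun_prop : Continuous fun f : TrigCurve N => (f, φ))

lemma measurable_indicator_sobolevBall (r N : ℕ) :
    Measurable ((sobolevBall r N).indicator (1 : TrigCurve N → ENNReal)) :=
  measurable_one.indicator (isClosed_sobolevBall r N).measurableSet

lemma measurable_slice_integrand (r N : ℕ) (φ : ℝ) :
    Measurable fun z : ((ℝ × ℝ) × (ℝ × ℝ)) × TrigCurve N => unitSquare z.2.constTerm *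
      ((sobolevBall r N).indicator 1
        (z.2 + TrigCurve.const N (z.1.1 - TrigCurve.eval z.2 φ)) *
      ENNReal.ofReal |cross (z.2.velocity φ) z.1.2|) := by
  have he := continuous_eval_left (N := N) φ
  have hv := continuous_velocity_left (N := N) φ
  have hc := TrigCurve.continuous_constCurve (N := N)
  have hcr : Continuous fun z : ((ℝ × ℝ) × (ℝ × ℝ)) × TrigCurve N =>
      cross (z.2.velocity φ) z.1.2 :=
    continuous_cross.comp (by fun_prop : Continuous fun z : ((ℝ × ℝ) × (ℝ × ℝ)) × TrigCurve N =>
      (z.2.velocity φ, z.1.2))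
  refine (measurable_unitSquare.comp (TrigCurve.measurable_constTerm.comp measurable_snd)).mul
    (((measurable_indicator_sobolevBall r N).comp ?_).mul ?_)
  · exact Continuous.measurable (by fun_prop)
  · exact (continuous_abs.comp hcr).measurable.ennreal_ofReal

lemma measurable_slice (r N : ℕ) (φ : ℝ) :
    Measurable fun z : (ℝ × ℝ) × (ℝ × ℝ) => slice r N φ z.1 z.2 :=
  (measurable_slice_integrand r N φ).lintegral_prod_right'

lemma lintegral_incidence_eq_slice (r N : ℕ) (t : ℝ × ℝ) :
    ∫⁻ p, incidence r N t p =
      ∫⁻ g in sobolevBall r N, slice r N t.1 (TrigCurve.eval g t.2) (g.velocity t.2) := by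
  have hm : Measurable (incidence r N t) := (measurable_incidence r N).comp
    (by fun_prop : Measurable fun p : TrigCurve N × TrigCurve N => (p, t))
  rw [Measure.volume_eq_prod, lintegral_prod_symm _ hm.aemeasurable,
    ← lintegral_indicator (isClosed_sobolevBall r N).measurableSet]
  refine lintegral_congr fun g => ?_
  by_cases hg : g ∈ sobolevBall r N
  · simp [incidence, slice, hg]
  · simp [incidence, hg]

/-- Integrating the conditional expectations against a function of the position. -/
lemma lintegral_mul_slice (r N : ℕ) (φ : ℝ) {k : ℝ × ℝ → ENNReal} (hk : Measurable k)
    (w : ℝ × ℝ) :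
    ∫⁻ u, k u * slice r N φ u w =
      ∫⁻ f in sobolevBall r N, k (TrigCurve.eval f φ) *
        ENNReal.ofReal |cross (f.velocity φ) w| := by
  have he := continuous_eval_left (N := N) φ
  have hv := continuous_velocity_left (N := N) φ
  have hc := TrigCurve.continuous_constCurve (N := N)
  have hBm : MeasurableSet (sobolevBall r N) := (isClosed_sobolevBall r N).measurableSet
  have hcr : Measurable fun f : TrigCurve N => ENNReal.ofReal |cross (f.velocity φ) w| :=
    (continuous_abs.comp (continuous_cross.comp (by fun_prop : Continuous fun f : TrigCurve N =>
      (f.velocity φ, w)))).measurable.ennreal_ofReal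
  have hM : Measurable fun z : (ℝ × ℝ) × TrigCurve N => unitSquare z.2.constTerm *
      ((sobolevBall r N).indicator 1 (z.2 + TrigCurve.const N (z.1 - TrigCurve.eval z.2 φ)) *
      ENNReal.ofReal |cross (z.2.velocity φ) w|) :=
    (measurable_slice_integrand r N φ).comp
      (by fun_prop : Measurable fun z : (ℝ × ℝ) × TrigCurve N => ((z.1, w), z.2))
  have hH : Measurable ((sobolevBall r N).indicator fun f => k (TrigCurve.eval f φ) *
      ENNReal.ofReal |cross (f.velocity φ) w|) :=
    ((hk.comp he.measurable).mul hcr).indicator hBm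
  rw [← lintegral_indicator hBm,
    lintegral_eq_lintegral_translates volume (volume : Measure (ℝ × ℝ))
      hc.measurable TrigCurve.measurable_constTerm TrigCurve.constTerm_add_const
      measurable_unitSquare lintegral_unitSquare
      hH]
  calc ∫⁻ u, k u * slice r N φ u w
      = ∫⁻ u, ∫⁻ f : TrigCurve N, k u * (unitSquare f.constTerm *
          ((sobolevBall r N).indicator 1 (f + TrigCurve.const N (u - TrigCurve.eval f φ)) *
            ENNReal.ofReal |cross (f.velocity φ) w|)) := by
        refine lintegral_congr fun u => ?_
        rw [slice, lintegral_const_mul]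
        exact hM.comp (by fun_prop : Measurable fun f : TrigCurve N => (u, f))
    _ = ∫⁻ f : TrigCurve N, ∫⁻ u, k u * (unitSquare f.constTerm *
          ((sobolevBall r N).indicator 1 (f + TrigCurve.const N (u - TrigCurve.eval f φ)) *
            ENNReal.ofReal |cross (f.velocity φ) w|)) :=
        lintegral_lintegral_swap ((hk.comp measurable_fst).mul hM).aemeasurable
    _ = _ := by
        refine lintegral_congr fun f => ?_
        -- Shifting `u` by `f(φ)` makes it the translation vector itself, matching the averaged form
        -- of the right-hand side.
        rw [← lintegral_add_right_eq_self _ (TrigCurve.eval f φ), ← lintegral_const_mul']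
        · refine lintegral_congr fun a => ?_
          rw [add_sub_cancel_right]
          by_cases h : f + TrigCurve.const N a ∈ sobolevBall r N
          · simp only [indicator_of_mem h, Pi.one_apply, TrigCurve.eval_add_const,
              TrigCurve.velocity_add_const, one_mul]
            rw [add_comm a]
            ring
          · simp [indicator_of_notMem h]
        · unfold unitSquare
          rw [indicator_apply]
          split_ifs <;> simp

/-- The jet distributions of the two curves enter with unknown constants `C` and `D`. Multiplying by
the square of the jet mass turns these into two factors of the ball volume, so the value does not
depend on `t`. -/
lemma lintegral_incidence_succ (r M : ℕ) (t : ℝ × ℝ) :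
    (∫⁻ p, incidence r (M + 1) t p) *
        ENNReal.ofReal (Real.pi ^ 2 / ((2 * M + 2) * (2 * M + 3))) ^ 2 =
      volume (sobolevBall r (M + 1)) ^ 2 * ENNReal.ofReal
        (lambdaNum r (M + 1) ^ 2 * (2 / muNum r (M + 1)) *
          (8 * Real.pi ^ 2 * halfBeta (2 * M + 1) ^ 2 / (4 * M + 6))) := by
  obtain ⟨C, -, -, hC⟩ := exists_lintegral_sobolevBall_eq r M t.1
  obtain ⟨D, -, -, hD⟩ := exists_lintegral_sobolevBall_eq r M t.2
  have hm : (2 * M + 1) ≠ 0 := by omega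
  have hmass : ENNReal.ofReal (Real.pi ^ 2 / ((2 * M + 2) * (2 * M + 3))) =
      ∫⁻ w, jetDensity (2 * M + 1) w := by
    rw [lintegral_jetDensity _ hm]
    congr 1
    push_cast
    ring
  have hvC : volume (sobolevBall r (M + 1)) = C * ∫⁻ w, jetDensity (2 * M + 1) w := by
    simpa using hC (fun _ => 1) measurable_const
  have hvD : volume (sobolevBall r (M + 1)) = D * ∫⁻ w, jetDensity (2 * M + 1) w := by
    simpa using hD (fun _ => 1) measurable_const
  set α := √(muNum r (M + 1) / 2) with hα
  have hα0 : 0 < α := Real.sqrt_pos.2 (half_pos (muNum_pos r _))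
  have hα2 : α ^ 2 = muNum r (M + 1) / 2 := Real.sq_sqrt (half_pos (muNum_pos r _)).le
  set l := lambdaNum r (M + 1) with hl
  have hl0 : 0 < l := lambdaNum_pos r M
  have hj := measurable_jetDensity (2 * M + 1)
  have hs := measurable_slice r (M + 1) t.1
  have hslice := fun (k : ℝ × ℝ → ENNReal) (hk : Measurable k) w =>
    lintegral_mul_slice r (M + 1) t.1 hk w
  rw [lintegral_incidence_eq_slice]
  generalize slice r (M + 1) t.1 = S at hs hslice ⊢
  have hcross (v w : ℝ × ℝ) : ENNReal.ofReal |cross (l • v) (l • w)| =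
      ENNReal.ofReal (l ^ 2) * ENNReal.ofReal |cross v w| := by
    rw [← ENNReal.ofReal_mul (by positivity), ← abs_of_nonneg (sq_nonneg l), ← abs_mul]
    congr 2
    simp [cross]; ring
  have hinner (w : ℝ × ℝ) : ∫⁻ u : ℝ × ℝ, jetDensity (2 * M + 1) (u, w) *
      S (α • u) (l • w) =
      ENNReal.ofReal (α ^ 2)⁻¹ * (C * (ENNReal.ofReal (l ^ 2) *
        ∫⁻ z : (ℝ × ℝ) × (ℝ × ℝ), jetDensity (2 * M + 1) z *
          (jetDensity (2 * M + 1) (z.1, w) * ENNReal.ofReal |cross z.2 w|))) := by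
    -- The test function fed into `lintegral_mul_slice` is the density of the second curve's jet at
    -- unnormalized position `u`; this forces the common position.
    have hk : Measurable fun u : ℝ × ℝ => jetDensity (2 * M + 1) (α⁻¹ • u, w) :=
      hj.comp (by fun_prop)
    have hsw : Measurable fun u : ℝ × ℝ => S u (l • w) :=
      hs.comp (by fun_prop : Measurable fun u : ℝ × ℝ => (u, l • w))
    have h1 := lintegral_comp_smul_plane hα0 (hk.mul hsw)
    simp only [Pi.mul_apply, inv_smul_smul₀ hα0.ne'] at h1
    have hcr : Measurable fun z : (ℝ × ℝ) × (ℝ × ℝ) => ENNReal.ofReal |cross z.2 (l • w)| := by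
      unfold cross; fun_prop
    have h2 := hC (fun z => jetDensity (2 * M + 1) (α⁻¹ • z.1, w) *
      ENNReal.ofReal |cross z.2 (l • w)|) ((hk.comp measurable_fst).mul hcr)
    rw [h1, hslice _ hk (l • w), h2]
    congr 2
    have hmz : Measurable fun z : (ℝ × ℝ) × (ℝ × ℝ) => jetDensity (2 * M + 1) z *
          (jetDensity (2 * M + 1) (z.1, w) * ENNReal.ofReal |cross z.2 w|) := by
      unfold jetDensity pairNormSq cross; fun_prop
    rw [← lintegral_const_mul _ hmz]
    refine lintegral_congr fun z => ?_
    rw [inv_smul_smul₀ hα0.ne', hcross]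
    ring
  have hmain : ∫⁻ g in sobolevBall r (M + 1), S (TrigCurve.eval g t.2) (g.velocity t.2) = D * (ENNReal.ofReal (α ^ 2)⁻¹ * (C *
      (ENNReal.ofReal (l ^ 2) * ENNReal.ofReal
        (8 * Real.pi ^ 2 * halfBeta (2 * M + 1) ^ 2 / (4 * M + 6))))) := by
    rw [hD (fun z => S z.1 z.2) hs,
      Measure.volume_eq_prod, lintegral_prod_symm]
    · simp only [hinner]
      have hmz : Measurable fun w : ℝ × ℝ => ∫⁻ z : (ℝ × ℝ) × (ℝ × ℝ), jetDensity (2 * M + 1) z *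
          (jetDensity (2 * M + 1) (z.1, w) * ENNReal.ofReal |cross z.2 w|) := by
        refine Measurable.lintegral_prod_right (f := fun w (z : (ℝ × ℝ) × (ℝ × ℝ)) =>
          jetDensity (2 * M + 1) z *
          (jetDensity (2 * M + 1) (z.1, w) * ENNReal.ofReal |cross z.2 w|)) ?_
        unfold Function.uncurry jetDensity pairNormSq cross
        fun_prop
      rw [lintegral_const_mul _ (by fun_prop), lintegral_const_mul _ (by fun_prop),
        lintegral_const_mul _ (by fun_prop), lintegral_jetDensity_mul_cross _ hm]
      congr 6
      push_cast
      ring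
    · refine (hj.mul (hs.comp ?_)).aemeasurable
      fun_prop
  have hsplit : ENNReal.ofReal (l ^ 2 * (2 / muNum r (M + 1)) *
      (8 * Real.pi ^ 2 * halfBeta (2 * M + 1) ^ 2 / (4 * M + 6))) =
      ENNReal.ofReal (α ^ 2)⁻¹ * (ENNReal.ofReal (l ^ 2) * ENNReal.ofReal
        (8 * Real.pi ^ 2 * halfBeta (2 * M + 1) ^ 2 / (4 * M + 6))) := by
    rw [← ENNReal.ofReal_mul (by positivity), ← ENNReal.ofReal_mul (by positivity), hα2, inv_div]
    congr 1
    ring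
  rw [hmain, hsplit, hmass, sq (volume _)]
  nth_rewrite 1 [hvC]
  rw [hvD]
  ring

/-! ### The mean value -/

/-- The average number of intersections. -/
def meanIntersections (r N : ℕ) : ℝ :=
  (2 : ℝ) ^ (8 * N + 3) * lambdaNum r N ^ 2 * ((2 * N).factorial : ℝ) ^ 4 * (2 * N + 1) /
    (muNum r N * ((4 * N + 1).factorial : ℝ) ^ 2)

lemma meanIntersections_succ (r M : ℕ) :
    meanIntersections r (M + 1) * (Real.pi ^ 2 / ((2 * M + 2) * (2 * M + 3))) ^ 2 =
      (2 * Real.pi) ^ 2 * (lambdaNum r (M + 1) ^ 2 * (2 / muNum r (M + 1)) *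
          (8 * Real.pi ^ 2 * halfBeta (2 * M + 1) ^ 2 / (4 * M + 6))) := by
  have h1 : (2 * (M + 1)).factorial = (2 * M + 2) * (2 * M + 1).factorial := by
    rw [← Nat.factorial_succ]; rfl
  have h2 : 4 * (M + 1) + 1 = 4 * M + 5 := by ring
  have h3 : 2 * (2 * M + 1) + 3 = 4 * M + 5 := by ring
  have h4 : (2 * M + 1 + 1).factorial = (2 * M + 2) * (2 * M + 1).factorial := Nat.factorial_succ _
  have hμ := (muNum_pos r (M + 1)).ne'
  have hf : ((4 * M + 5).factorial : ℝ) ≠ 0 := by positivity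
  have h6 : (4 * M + 6 : ℝ) ≠ 0 := by positivity
  have h7 : (2 * M + 2 : ℝ) ≠ 0 := by positivity
  have h8 : (2 * M + 3 : ℝ) ≠ 0 := by positivity
  unfold meanIntersections halfBeta
  rw [h1, h2, h3, h4]
  push_cast
  field_simp
  ring

lemma lintegral_encard_eq (r N : ℕ) :
    ∫⁻ p in sobolevBallSq r N, ((intersectionParams p).encard : ENNReal) =
      volume (sobolevBallSq r N) * ENNReal.ofReal (meanIntersections r N) := by
  rw [lintegral_encard_intersectionParams]
  cases N with
  | zero =>
    -- In degree `0` the curves are constant, so the incidence vanishes; so does the claimed mean,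
    -- since `λ = 0`.
    have hv (f : TrigCurve 0) (φ : ℝ) : f.velocity φ = 0 := by
      simp [TrigCurve.velocity, eval_eq, derivCoeff]
    have h0 : meanIntersections r 0 = 0 := by simp [meanIntersections, lambdaNum]
    simp [incidence, hv, cross, h0]
  | succ M =>
    set R := Real.pi ^ 2 / ((2 * M + 2) * (2 * M + 3) : ℝ) with hR
    have hR0 : 0 < R := by positivity
    have hR0' : ENNReal.ofReal R ^ 2 ≠ 0 := by simp [hR0]
    have hRt : ENNReal.ofReal R ^ 2 ≠ ⊤ := by simp
    have hsq : volume (sobolevBallSq r (M + 1)) = volume (sobolevBall r (M + 1)) ^ 2 := by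
      rw [sobolevBallSq, Measure.volume_eq_prod, Measure.prod_prod, sq]
    have hS : volume (Ico 0 (2 * Real.pi) ×ˢ Ico 0 (2 * Real.pi)) =
        ENNReal.ofReal ((2 * Real.pi) ^ 2) := by
      rw [Measure.volume_eq_prod, Measure.prod_prod, Real.volume_Ico, sub_zero,
        ← ENNReal.ofReal_mul (by positivity), sq]
    have hm : 0 ≤ meanIntersections r (M + 1) := by
      have := muNum_pos r (M + 1)
      unfold meanIntersections; positivity
    refine (ENNReal.mul_left_inj hR0' hRt).1 ?_
    have hin (t : ℝ × ℝ) : (∫⁻ p, incidence r (M + 1) t p) * ENNReal.ofReal R ^ 2 = _ :=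
      lintegral_incidence_succ r M t
    rw [← lintegral_mul_const' _ _ hRt]
    simp only [hin]
    have hval : ENNReal.ofReal (meanIntersections r (M + 1)) * ENNReal.ofReal R ^ 2 =
        ENNReal.ofReal ((2 * Real.pi) ^ 2) * ENNReal.ofReal
          (lambdaNum r (M + 1) ^ 2 * (2 / muNum r (M + 1)) *
            (8 * Real.pi ^ 2 * halfBeta (2 * M + 1) ^ 2 / (4 * M + 6))) := by
      rw [← ENNReal.ofReal_pow hR0.le, ← ENNReal.ofReal_mul hm, hR, meanIntersections_succ,
        ENNReal.ofReal_mul (by positivity)]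
    rw [setLIntegral_const, hS, hsq, mul_assoc _ (ENNReal.ofReal (meanIntersections r (M + 1))),
      hval]
    ring

lemma volume_sobolevBallSq_succ (r M : ℕ) :
    volume (sobolevBallSq r (M + 1)) ≠ 0 ∧ volume (sobolevBallSq r (M + 1)) ≠ ⊤ := by
  obtain ⟨C, hC0, hCt, hC⟩ := exists_lintegral_sobolevBall_eq r M 0
  have hv : volume (sobolevBall r (M + 1)) = C * ∫⁻ w, jetDensity (2 * M + 1) w := by
    simpa using hC (fun _ => 1) measurable_const
  rw [lintegral_jetDensity _ (by omega)] at hv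
  rw [sobolevBallSq, Measure.volume_eq_prod, Measure.prod_prod, hv]
  have h0 : ENNReal.ofReal (Real.pi ^ 2 / (((2 * M + 1 : ℕ) + 1) * ((2 * M + 1 : ℕ) + 2))) ≠ 0 := by
    rw [Ne, ENNReal.ofReal_eq_zero, not_le]
    positivity
  exact ⟨mul_ne_zero (mul_ne_zero hC0 h0) (mul_ne_zero hC0 h0),
    ENNReal.mul_ne_top (ENNReal.mul_ne_top hCt ENNReal.ofReal_ne_top)
      (ENNReal.mul_ne_top hCt ENNReal.ofReal_ne_top)⟩

lemma lintegral_encard_ne_top (r N : ℕ) :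
    ∫⁻ p in sobolevBallSq r N, ((intersectionParams p).encard : ENNReal) ≠ ⊤ := by
  rw [lintegral_encard_eq]
  cases N with
  | zero => simp [meanIntersections, lambdaNum]
  | succ M => exact ENNReal.mul_ne_top (volume_sobolevBallSq_succ r M).2 ENNReal.ofReal_ne_top

/-! ### Almost sure finiteness and the series of relative volumes -/

lemma measurableSet_sobolevBallSq (r N : ℕ) : MeasurableSet (sobolevBallSq r N) :=
  (isClosed_sobolevBall r N).measurableSet.prod (isClosed_sobolevBall r N).measurableSet

/-- Almost all pairs of curves from the unit ball have finitely many intersections, at which no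
curve passes more than once. -/
lemma ae_finite_intersectionParams (r N : ℕ) :
    ∀ᵐ p : TrigCurve N × TrigCurve N, p ∈ sobolevBallSq r N →
      (intersectionParams p).Finite ∧
        (intersectionPoints p).encard = (intersectionParams p).encard := by
  have hm := measurable_encard_intersectionParams N
  have hfin := (ae_restrict_iff' (measurableSet_sobolevBallSq r N)).1
    (ae_lt_top hm (lintegral_encard_ne_top r N))
  have hfin' : ∀ᵐ p : TrigCurve N × TrigCurve N, p ∈ sobolevBallSq r N →
      (intersectionParams p).Finite := by
    filter_upwards [hfin] with p hp hB
    have := hp hB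
    rw [← encard_lt_top_iff]
    simpa using this
  cases N with
  | zero =>
    -- Constant curves retrace their single point, so the double point argument fails in degree `0`;
    -- instead, almost no pairs intersect.
    have h0 : ∫⁻ p in sobolevBallSq r 0, ((intersectionParams p).encard : ENNReal) = 0 := by
      rw [lintegral_encard_eq]
      simp [meanIntersections, lambdaNum]
    have h1 := (ae_restrict_iff' (measurableSet_sobolevBallSq r 0)).1
      ((lintegral_eq_zero_iff hm).1 h0)
    filter_upwards [hfin', h1] with p hp h hB
    have he : intersectionParams p = ∅ := by simpa using h hB
    exact ⟨hp hB, by rw [← image_intersectionParams, he]; simp⟩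
  | succ M =>
    filter_upwards [hfin', ae_encard_intersectionPoints M] with p hp h hB
    exact ⟨hp hB, h⟩

lemma pairsWithIntersections_ae_eq (r N i : ℕ) :
    pairsWithIntersections r N i =ᵐ[volume]
      (sobolevBallSq r N ∩ {p | (intersectionParams p).encard = i} : Set _) := by
  filter_upwards [ae_finite_intersectionParams r N] with p hp
  refine propext (and_congr_right fun hB => ?_)
  change (intersectionPoints p).encard = i ↔ (intersectionParams p).encard = i
  rw [(hp hB).2]

lemma tsum_mul_volume_pairsWithIntersections (r N : ℕ) :
    ∑' i : ℕ, (i : ENNReal) * volume (pairsWithIntersections r N i) =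
      volume (sobolevBallSq r N) * ENNReal.ofReal (meanIntersections r N) := by
  have hB := measurableSet_sobolevBallSq r N
  have hM := measurableSet_intersectionParams_encard_eq N
  rw [← lintegral_encard_eq]
  calc ∑' i : ℕ, (i : ENNReal) * volume (pairsWithIntersections r N i)
      = ∑' i : ℕ, ∫⁻ p in sobolevBallSq r N,
          {p | (intersectionParams p).encard = i}.indicator (fun _ => (i : ENNReal)) p := by
        refine tsum_congr fun i => ?_
        rw [lintegral_indicator_const (hM i), Measure.restrict_apply (hM i), inter_comm,
          measure_congr (pairsWithIntersections_ae_eq r N i)]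
    _ = ∫⁻ p in sobolevBallSq r N, ∑' i : ℕ,
          {p | (intersectionParams p).encard = i}.indicator (fun _ => (i : ENNReal)) p :=
        (lintegral_tsum fun i => (measurable_const.indicator (hM i)).aemeasurable).symm
    _ = _ := by
        refine lintegral_congr_ae ((ae_restrict_iff' hB).2 ?_)
        filter_upwards [ae_finite_intersectionParams r N] with p hp hpB
        obtain ⟨k, hk⟩ := ENat.ne_top_iff_exists.1 (hp hpB).1.encard_lt_top.ne
        -- Almost surely the count is a finite `k`, so exactly one indicator contributes; an
        -- infinite count would be missed by the series.
        rw [tsum_eq_single k]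
        · simp [← hk]
        · intro i hi
          refine indicator_of_notMem (fun h => hi ?_) _
          have : (intersectionParams p).encard = i := h
          rw [← hk] at this
          exact_mod_cast this.symm

lemma hasSum_mul_relVolume (r N : ℕ) :
    HasSum (fun i : ℕ => (i : ℝ) * relVolume r N volume i) (meanIntersections r N) := by
  have hsum := tsum_mul_volume_pairsWithIntersections r N
  have hne : ∑' i : ℕ, (i : ENNReal) * volume (pairsWithIntersections r N i) ≠ ⊤ := by
    rw [hsum, ← lintegral_encard_eq]; exact lintegral_encard_ne_top r N
  have hnn : 0 ≤ meanIntersections r N := by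
    have := muNum_pos r N
    unfold meanIntersections; positivity
  have h := ENNReal.hasSum_toReal hne
  rw [← ENNReal.tsum_toReal_eq (ENNReal.ne_top_of_tsum_ne_top hne), hsum, ENNReal.toReal_mul,
    ENNReal.toReal_ofReal hnn] at h
  simp only [ENNReal.toReal_mul, ENNReal.toReal_natCast] at h
  have h' := h.div_const (volume (sobolevBallSq r N)).toReal
  cases N with
  | zero =>
    have h0 : meanIntersections r 0 = 0 := by simp [meanIntersections, lambdaNum]
    rw [h0] at h' ⊢
    simpa [relVolume, measureReal_def, mul_div_assoc] using h'
  | succ M =>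
    obtain ⟨hv0, hvt⟩ := volume_sobolevBallSq_succ r M
    have hv := ENNReal.toReal_ne_zero.2 ⟨hv0, hvt⟩
    rw [mul_div_cancel_left₀ _ hv] at h'
    simpa only [relVolume, measureReal_def, mul_div_assoc] using h'

end

/-- The average number `∑ i · A_i` of intersection points of two trigonometric curves of degree
`≤ N` from the unit ball of the `W₂ʳ` metric. The first conjunct says that for almost all pairs the
number of intersection points is finite and unambiguous, the second one that the volumes of the sets
of pairs with exactly `i` intersection points are well defined. -/
theorem theorem2 (r N : ℕ) (vol : Measure (TrigCurve N × TrigCurve N))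
    [vol.IsAddHaarMeasure] :
    (∀ᵐ p ∂vol, p ∈ sobolevBallSq r N →
      (intersectionParams p).Finite ∧
        (intersectionPoints p).encard = (intersectionParams p).encard) ∧
    (∀ i : ℕ, NullMeasurableSet (pairsWithIntersections r N i) vol) ∧
    HasSum (fun i : ℕ => (i : ℝ) * relVolume r N vol i)
      ((2 : ℝ) ^ (8 * N + 3) * lambdaNum r N ^ 2 * ((2 * N).factorial : ℝ) ^ 4 * (2 * N + 1) /
        (muNum r N * ((4 * N + 1).factorial : ℝ) ^ 2)) := by
  -- Every Haar measure is a positive multiple of `volume`: null sets agree and the factor cancels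
  -- in the relative volumes.
  have hvol := Measure.isAddLeftInvariant_eq_smul vol volume
  have hpos := Measure.addHaarScalarFactor_pos_of_isAddHaarMeasure vol volume
  set c := vol.addHaarScalarFactor volume
  have hac : vol ≪ volume := by
    rw [hvol]; exact Measure.smul_absolutelyContinuous
  refine ⟨hac.ae_le (ae_finite_intersectionParams r N), fun i => ?_, ?_⟩
  · refine NullMeasurableSet.mono_ac ?_ hac
    exact ((measurableSet_sobolevBallSq r N).inter
      (measurableSet_intersectionParams_encard_eq N i)).nullMeasurableSet.congr
      (pairsWithIntersections_ae_eq r N i).symm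
  · have hrel : ∀ i, relVolume r N vol i = relVolume r N volume i := fun i => by
      have hc : (c : ℝ) ≠ 0 := by exact_mod_cast hpos.ne'
      rw [hvol, relVolume, relVolume, measureReal_nnreal_smul_apply, measureReal_nnreal_smul_apply,
        mul_div_mul_left _ _ hc]
    simp only [hrel]
    exact hasSum_mul_relVolume r N
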